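/- A regular closed curve $M$ is a $C^\infty$ map $f:S^1=\mathbb{R}/\mathbb{Z}\to\mathbb{R}^2$ with nowhere vanishing velocity (self-intersections are allowed); the space of such curves carries the $C^\infty$ topology (uniform convergence of all derivatives). A pair of points $a=f(x)\neq b=f(y)$ of $M$ is a parallel pair if $f'(x)$ and $f'(y)$ are parallel, and for $\lambda\in\mathbb{R}$ the affine $\lambda$-equidistant $E_\lambda(M)$ is the closure of $\{\lambda a+(1-\lambda)b : a,b \text{ is a parallel pair of } M\}$; $E_{1/2}(M)$ is the Wigner caustic. Let $P\subset S^1\times S^1$ be the closure of the set of parameter pairs $(x,y)$ for which $f(x),f(y)$ is a parallel pair. A smooth branch of $E_\lambda(M)$, $\lambda\ne 0,1$, is a parametrized curve $C(\tau)=\lambda f(s(\tau))+(1-\lambda)f(t(\tau))$, where $\tau\mapsto(s(\tau),t(\tau))$ is a smooth path in $P$ with nowhere vanishing velocity which is one of the following: (a) a closed branch: $\tau\in\mathbb{R}$, and for all $\tau,\tau'$ the pairs at $\tau$ and $\tau'$ coincide if and only if $\tau'-\tau\in\mathbb{Z}$; (b) (only for $\lambda=\frac12$) a branch connecting two inflexion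 points of $M$: $\tau\in[0,1]$, no pair is attained twice, and $s(0)=t(0)$, $s(1)=t(1)$ in $S^1$. Here pairs are ordered if $\lambda\neq\frac12$ and unordered if $\lambda=\frac12$. An inflexion point of $C$ is a parameter $\tau$ with $C'(\tau)\neq0$ and $\det(C'(\tau),C''(\tau))=0$; inflexion points are counted by parameters, modulo $1$ in case (a) and in $(0,1)$ in case (b). **Proposition.** There is an open dense set of regular closed curves such that for every $M$ in this set and every $\lambda\in\mathbb{R}\setminus\{0,1\}$ (in particular for generic $\lambda$, and for $\lambda=\frac12$) the number of inflexion points on each smooth branch of $E_\lambda(M)$ is finite and even. -/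

import Mathlib

open Set Topology
open scoped ContDiff

/-- The affine plane `ℝ²`. -/
abbrev Plane : Type := EuclideanSpace ℝ (Fin 2)

/-- The determinant `det [u, v]` of two plane vectors. -/
def planeDet (u v : Plane) : ℝ := u 0 * v 1 - u 1 * v 0

/-- A regular closed curve: a `C^∞` map from the circle `ℝ / ℤ` to the plane (written as a map on `ℝ`
of period `1`) with nowhere vanishing velocity. Self-intersections are allowed. -/
structure RegularClosedCurve where
  toFun : ℝ → Plane
  smooth : ContDiff ℝ ∞ toFun
  periodic : Function.Periodic toFun 1
  regular : ∀ x, deriv toFun x ≠ 0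

namespace RegularClosedCurve

instance : CoeFun RegularClosedCurve (fun _ => ℝ → Plane) := ⟨RegularClosedCurve.toFun⟩

/-- The `C^∞` topology: uniform convergence of the derivatives of every order `k ≥ 0`. -/
noncomputable instance : TopologicalSpace RegularClosedCurve :=
  ⨅ k : ℕ, TopologicalSpace.induced
    (fun f : RegularClosedCurve => UniformFun.ofFun (iteratedDeriv k f.toFun)) inferInstance

/-- The parameter pairs `(x, y)` for which `f x`, `f y` is a parallel pair: two different points of
the curve at which the tangent lines are parallel. -/
def parallelPairs (f : RegularClosedCurve) : Set (ℝ × ℝ) :=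
  {p | f p.1 ≠ f p.2 ∧ planeDet (deriv f p.1) (deriv f p.2) = 0}

/-- The `lam`-point map, in parameters: `(x, y) ↦ lam f(x) + (1 - lam) f(y)`. -/
noncomputable def pointMap (f : RegularClosedCurve) (lam : ℝ) (p : ℝ × ℝ) : Plane :=
  lam • f p.1 + (1 - lam) • f p.2

/-- The affine `lam`-equidistant `E_lam(M)` of the curve. -/
def affineEquidistant (f : RegularClosedCurve) (lam : ℝ) : Set Plane :=
  closure (f.pointMap lam '' f.parallelPairs)

/-- Two parameter pairs represent the same pair of points on the source circles: they are equal modulo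
`ℤ × ℤ`; for `lam = 1/2`, where `lam a + (1 - lam) b` is symmetric in `a` and `b`, the pairs are
unordered, i.e. exchanging the two entries is allowed as well. -/
def SamePair (lam : ℝ) (p q : ℝ × ℝ) : Prop :=
  (∃ m n : ℤ, q.1 = p.1 + m ∧ q.2 = p.2 + n) ∨
    (lam = 1 / 2 ∧ ∃ m n : ℤ, q.1 = p.2 + m ∧ q.2 = p.1 + n)

/-- `pair` parametrizes a closed smooth branch `τ ↦ lam f(s(τ)) + (1 - lam) f(t(τ))` of `E_lam(M)`,
where `pair τ = (s(τ), t(τ))`: it is a smooth regular path of parallel pairs (or limits of parallel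
pairs) which returns to the initial pair after time `1` and runs through no pair twice in between.
So it runs once through a whole component of the curve of parallel pairs. -/
structure IsClosedBranch (f : RegularClosedCurve) (lam : ℝ) (pair : ℝ → ℝ × ℝ) : Prop where
  smooth : ContDiff ℝ ∞ pair
  regular : ∀ τ, deriv pair τ ≠ 0
  mem : ∀ τ, pair τ ∈ closure f.parallelPairs
  samePair_iff : ∀ τ τ', SamePair lam (pair τ) (pair τ') ↔ ∃ n : ℤ, τ' = τ + n

/-- `pair` parametrizes, on `[0, 1]`, a smooth branch of the Wigner caustic `E_{1/2}(M)` which connects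
two inflexion points of `M`: a smooth regular path of parallel pairs (or limits of parallel pairs),
without repetition, which begins and ends at limit pairs `(p, p)`. (Parallel pairs with different
parameters that merge do so only at inflexion points.) -/
structure IsOnShellBranch (f : RegularClosedCurve) (pair : ℝ → ℝ × ℝ) : Prop where
  smooth : ContDiff ℝ ∞ pair
  regular : ∀ τ ∈ Icc (0 : ℝ) 1, deriv pair τ ≠ 0
  mem : ∀ τ ∈ Icc (0 : ℝ) 1, pair τ ∈ closure f.parallelPairs
  injective : ∀ τ ∈ Icc (0 : ℝ) 1, ∀ τ' ∈ Icc (0 : ℝ) 1,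
    SamePair (1 / 2) (pair τ) (pair τ') → τ = τ'
  start_diag : ∃ n : ℤ, (pair 0).2 = (pair 0).1 + n
  end_diag : ∃ n : ℤ, (pair 1).2 = (pair 1).1 + n

/-- The points of a branch lie on the affine equidistant. -/
theorem pointMap_mem_affineEquidistant (f : RegularClosedCurve) (lam : ℝ) {p : ℝ × ℝ}
    (hp : p ∈ closure f.parallelPairs) : f.pointMap lam p ∈ f.affineEquidistant lam := by
  have hf : Continuous f.toFun := f.smooth.continuous
  have hc : Continuous (f.pointMap lam) := by
    unfold pointMap
    fun_prop
  exact image_closure_subset_closure_image hc ⟨p, hp, rfl⟩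

end RegularClosedCurve

/-- The smooth parametrized plane curve `c` has an inflexion point at the parameter `τ`: `c` is regular
there and its curvature vanishes (contact of order at least `2` with the tangent line). -/
def IsInflexion (c : ℝ → Plane) (τ : ℝ) : Prop :=
  deriv c τ ≠ 0 ∧ planeDet (deriv c τ) (deriv (deriv c) τ) = 0

/-! The generic curves are those whose inflexion points are nondegenerate and have pairwise
nonparallel tangents (`genericSet`). Openness is a compactness argument. For density, degenerate
inflexions are first removed by a trigonometric perturbation of degree two: the bad coefficients
form the `C^1` image of a 7-dimensional space in an 8-dimensional one. Then the tangents at the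
finitely many inflexions are turned at different speeds, without moving these inflexions along the
parameter circle.

For the parity, let `κ` be the angular speed of the tangent line of `M`. Along a path `(s, t)` of
parallel pairs both tangents turn together, so `κ(s) s' = κ(t) t'` (`angularSpeed_mul_deriv_eq`). A
branch `C` has this same tangent direction, and `det(C', C'')` is this common turning speed times a
factor that is nonzero exactly where `C' ≠ 0` (`isInflexion_iff`). Nondegeneracy of the inflexions
of `M` makes every zero of the turning speed simple (`deriv_turning_ne_zero`), and genericity makes
the branch regular at these zeros.

On a closed branch the turning speed has period `1`, even when the period exchanges `s` and `t`,
because it is symmetric in them. A periodic function with simple zeros has evenly many per period.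

On a branch joining two inflexions of `M` the turning speed vanishes at both ends, so its end signs
say nothing. In the interior it has the same zeros as `s' t'`, whose zeros are simple as well. At
the ends the path crosses the diagonal with `t' = -s' ≠ 0` (`deriv_eq_neg_of_diag`), so `s' t' < 0`
there, and equal end signs give an even count.

At a diagonal pair the path folds onto itself as a path of unordered pairs
(`exists_samePair_of_diag`). For `λ = 1/2` this keeps closed branches, and the interior of the other
branches, away from the diagonal. -/

open Filter

/-! ### Algebra and calculus of the plane determinant -/

section PlaneDet

theorem planeDet_self (u : Plane) : planeDet u u = 0 := by simp [planeDet, mul_comm]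

theorem planeDet_swap (u v : Plane) : planeDet u v = -planeDet v u := by
  simp [planeDet]; ring

theorem planeDet_add_right (u v w : Plane) :
    planeDet u (v + w) = planeDet u v + planeDet u w := by
  simp [planeDet]; ring

theorem planeDet_smul_left (r : ℝ) (u v : Plane) : planeDet (r • u) v = r * planeDet u v := by
  simp [planeDet]; ring

theorem planeDet_smul_right (r : ℝ) (u v : Plane) : planeDet u (r • v) = r * planeDet u v := by
  simp [planeDet]; ring

theorem continuous_planeDet : Continuous fun p : Plane × Plane => planeDet p.1 p.2 := by
  unfold planeDet; fun_prop

/-- The squared length of a plane vector. -/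
def planeSq (u : Plane) : ℝ := u 0 * u 0 + u 1 * u 1

theorem planeSq_pos {u : Plane} (hu : u ≠ 0) : 0 < planeSq u := by
  unfold planeSq
  by_contra h
  apply hu
  ext i
  fin_cases i <;> simp <;> nlinarith [mul_self_nonneg (u 0), mul_self_nonneg (u 1)]

theorem planeSq_smul (r : ℝ) (u : Plane) : planeSq (r • u) = r ^ 2 * planeSq u := by
  simp [planeSq]; ring

theorem exists_smul_of_planeDet_eq_zero {u v : Plane} (hu : u ≠ 0) (h : planeDet u v = 0) :
    ∃ r : ℝ, v = r • u := by
  have hp := planeSq_pos hu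
  refine ⟨(u 0 * v 0 + u 1 * v 1) / planeSq u, ?_⟩
  unfold planeDet at h
  ext i
  rw [PiLp.smul_apply, smul_eq_mul, div_mul_eq_mul_div, eq_div_iff hp.ne', planeSq]
  revert i
  rw [Fin.forall_fin_two]
  constructor
  · linear_combination (-u 1) * h
  · linear_combination (u 0) * h

theorem planeDet_eq_zero_trans {u v w : Plane} (hv : v ≠ 0) (h₁ : planeDet u v = 0)
    (h₂ : planeDet v w = 0) : planeDet u w = 0 := by
  obtain ⟨r, rfl⟩ := exists_smul_of_planeDet_eq_zero hv h₂
  rw [planeDet_smul_right, h₁, mul_zero]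

theorem HasDerivAt.plane_apply {u : ℝ → Plane} {u' : Plane} {x : ℝ} (h : HasDerivAt u u' x)
    (i : Fin 2) : HasDerivAt (fun z => u z i) (u' i) x :=
  (EuclideanSpace.proj i : Plane →L[ℝ] ℝ).hasFDerivAt.comp_hasDerivAt x h

theorem HasDerivAt.planeDet {u v : ℝ → Plane} {u' v' : Plane} {x : ℝ} (hu : HasDerivAt u u' x)
    (hv : HasDerivAt v v' x) :
    HasDerivAt (fun z => planeDet (u z) (v z)) (planeDet u' (v x) + planeDet (u x) v') x := by
  have := ((hu.plane_apply 0).mul (hv.plane_apply 1)).sub ((hu.plane_apply 1).mul (hv.plane_apply 0))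
  refine this.congr_deriv ?_
  simp only [_root_.planeDet]; ring

theorem HasDerivAt.planeSq {u : ℝ → Plane} {u' : Plane} {x : ℝ} (hu : HasDerivAt u u' x) :
    HasDerivAt (fun z => planeSq (u z)) (2 * (u x 0 * u' 0 + u x 1 * u' 1)) x := by
  have := ((hu.plane_apply 0).mul (hu.plane_apply 0)).add ((hu.plane_apply 1).mul (hu.plane_apply 1))
  refine this.congr_deriv ?_
  ring

end PlaneDet

theorem Function.Periodic.iteratedDeriv {E : Type*} [NormedAddCommGroup E] [NormedSpace ℝ E]
    {g : ℝ → E} {c : ℝ} (hg : Function.Periodic g c) (k : ℕ) :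
    Function.Periodic (iteratedDeriv k g) c := by
  intro x
  have h := congrFun (iteratedDeriv_comp_add_const k g c) x
  rw [← h]
  congr 1
  exact funext hg

theorem ContDiff.hasDerivAt_iteratedDeriv {E : Type*} [NormedAddCommGroup E] [NormedSpace ℝ E]
    {g : ℝ → E} (hg : ContDiff ℝ ∞ g) (k : ℕ) (x : ℝ) :
    HasDerivAt (iteratedDeriv k g) (iteratedDeriv (k + 1) g x) x := by
  rw [iteratedDeriv_succ]
  exact ((hg.differentiable_iteratedDeriv k (by exact_mod_cast ENat.natCast_lt_top k)) x).hasDerivAt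

theorem Function.Periodic.bounded_of_continuous {E : Type*} [NormedAddCommGroup E]
    {g : ℝ → E} (hp : Function.Periodic g 1) (hc : Continuous g) : ∃ M, ∀ x, ‖g x‖ ≤ M := by
  obtain ⟨M, hM⟩ := isCompact_Icc.exists_bound_of_continuousOn (s := Icc (0 : ℝ) 1) hc.continuousOn
  refine ⟨M, fun x => ?_⟩
  obtain ⟨y, hy, hxy⟩ := hp.exists_mem_Ico₀ one_pos x
  rw [hxy]
  exact hM y (Ico_subset_Icc_self hy)

/-! ### Derivatives, curvature and the `C^∞` topology -/

namespace RegularClosedCurve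

variable (f : RegularClosedCurve)

/-- The derivative of order `k` of the curve. -/
noncomputable def d (k : ℕ) : ℝ → Plane := iteratedDeriv k f.toFun

theorem d_one : f.d 1 = deriv f.toFun := iteratedDeriv_one

theorem hasDerivAt_d (k : ℕ) (x : ℝ) : HasDerivAt (f.d k) (f.d (k + 1) x) x :=
  f.smooth.hasDerivAt_iteratedDeriv k x

theorem continuous_d (k : ℕ) : Continuous (f.d k) :=
  continuous_iff_continuousAt.2 fun x => (f.hasDerivAt_d k x).continuousAt

theorem d_one_ne_zero (x : ℝ) : f.d 1 x ≠ 0 := by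
  rw [d_one]; exact f.regular x

theorem d_add_int (k : ℕ) (x : ℝ) (n : ℤ) : f.d k (x + n) = f.d k x := by
  have h := (f.periodic.iteratedDeriv k).int_mul n x
  simpa [d] using h

/-- The numerator `det (f', f'')` of the curvature. -/
noncomputable def curv (x : ℝ) : ℝ := planeDet (f.d 1 x) (f.d 2 x)

/-- The derivative `det (f', f''')` of `curv`. -/
noncomputable def curvDeriv (x : ℝ) : ℝ := planeDet (f.d 1 x) (f.d 3 x)

theorem hasDerivAt_curv (x : ℝ) : HasDerivAt f.curv (f.curvDeriv x) x := by
  refine ((f.hasDerivAt_d 1 x).planeDet (f.hasDerivAt_d 2 x)).congr_deriv ?_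
  rw [planeDet_self, zero_add, curvDeriv]

theorem curv_add_int (x : ℝ) (n : ℤ) : f.curv (x + n) = f.curv x := by simp [curv, d_add_int]

theorem curvDeriv_add_int (x : ℝ) (n : ℤ) : f.curvDeriv (x + n) = f.curvDeriv x := by
  simp [curvDeriv, d_add_int]

/-- All inflexion points of the curve are nondegenerate. -/
def HasSimpleInflexions : Prop := ∀ x, f.curv x = 0 → f.curvDeriv x ≠ 0

/-- The parameters `x`, `y` do not represent two different inflexion points with parallel tangents. -/
def InflexionsNotParallel (x y : ℝ) : Prop :=
  f.curv x = 0 → f.curv y = 0 → planeDet (f.d 1 x) (f.d 1 y) = 0 → ∃ n : ℤ, y = x + n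

theorem tendsto_nhds_iff {ι : Type*} {l : Filter ι} {F : ι → RegularClosedCurve} :
    Tendsto F l (𝓝 f) ↔ ∀ k, TendstoUniformly (fun i => (F i).d k) (f.d k) l := by
  rw [nhds_iInf, tendsto_iInf]
  refine forall_congr' fun k => ?_
  rw [nhds_induced, tendsto_comap_iff, UniformFun.tendsto_iff_tendstoUniformly]
  rfl

theorem continuous_eval_d (k : ℕ) :
    Continuous fun p : RegularClosedCurve × ℝ => p.1.d k p.2 := by
  rw [continuous_iff_continuousAt]
  rintro ⟨f, x⟩
  have h := (f.tendsto_nhds_iff (l := 𝓝 f) (F := id)).1 tendsto_id k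
  rw [ContinuousAt, Metric.tendsto_nhds]
  intro ε hε
  have h₁ := Metric.tendstoUniformly_iff.1 h (ε / 2) (half_pos hε)
  have h₂ := Metric.tendsto_nhds.1 ((f.continuous_d k).tendsto x) (ε / 2) (half_pos hε)
  rw [nhds_prod_eq]
  filter_upwards [h₁.prod_mk h₂] with p hp
  calc dist (p.1.d k p.2) (f.d k x) ≤ dist (p.1.d k p.2) (f.d k p.2) + dist (f.d k p.2) (f.d k x) :=
        dist_triangle _ _ _
    _ < ε / 2 + ε / 2 := add_lt_add (by rw [dist_comm]; exact hp.1 p.2) hp.2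
    _ = ε := add_halves ε

theorem continuous_eval_curv : Continuous fun p : RegularClosedCurve × ℝ => p.1.curv p.2 :=
  continuous_planeDet.comp ((continuous_eval_d 1).prodMk (continuous_eval_d 2))

theorem continuous_eval_curvDeriv : Continuous fun p : RegularClosedCurve × ℝ => p.1.curvDeriv p.2 :=
  continuous_planeDet.comp ((continuous_eval_d 1).prodMk (continuous_eval_d 3))

theorem continuous_curv : Continuous f.curv :=
  continuous_iff_continuousAt.2 fun x => (f.hasDerivAt_curv x).continuousAt

end RegularClosedCurve

/-! ### Openness of the generic set -/

namespace RegularClosedCurve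

variable (f : RegularClosedCurve)

theorem continuous_eval_fst_curv :
    Continuous fun p : RegularClosedCurve × ℝ × ℝ => p.1.curv p.2.1 :=
  continuous_eval_curv.comp (f := fun p : RegularClosedCurve × ℝ × ℝ => (p.1, p.2.1)) (by fun_prop)

theorem continuous_eval_snd_curv :
    Continuous fun p : RegularClosedCurve × ℝ × ℝ => p.1.curv p.2.2 :=
  continuous_eval_curv.comp (f := fun p : RegularClosedCurve × ℝ × ℝ => (p.1, p.2.2)) (by fun_prop)

theorem continuous_eval_planeDet :
    Continuous fun p : RegularClosedCurve × ℝ × ℝ => planeDet (p.1.d 1 p.2.1) (p.1.d 1 p.2.2) := by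
  have h₁ : Continuous fun p : RegularClosedCurve × ℝ × ℝ => p.1.d 1 p.2.1 :=
    (continuous_eval_d 1).comp (f := fun p : RegularClosedCurve × ℝ × ℝ => (p.1, p.2.1))
      (by fun_prop)
  have h₂ : Continuous fun p : RegularClosedCurve × ℝ × ℝ => p.1.d 1 p.2.2 :=
    (continuous_eval_d 1).comp (f := fun p : RegularClosedCurve × ℝ × ℝ => (p.1, p.2.2))
      (by fun_prop)
  exact continuous_planeDet.comp (h₁.prodMk h₂)

/-- Jointly in the curve and the two parameters, nearby zeros of the curvature coincide. -/
theorem eventually_unique_zero_curv {x : ℝ} (h : f.curv x = 0 → f.curvDeriv x ≠ 0) :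
    ∀ᶠ p : RegularClosedCurve × ℝ × ℝ in 𝓝 (f, x, x),
      p.1.curv p.2.1 = 0 → p.1.curv p.2.2 = 0 → p.2.1 = p.2.2 := by
  by_cases h₀ : f.curv x = 0
  · have h₁ : ∀ᶠ p : RegularClosedCurve × ℝ in 𝓝 (f, x), p.1.curvDeriv p.2 ≠ 0 :=
      continuous_eval_curvDeriv.continuousAt.eventually_ne (h h₀)
    rw [nhds_prod_eq, eventually_prod_iff] at h₁
    obtain ⟨P, hP, Q, hQ, hPQ⟩ := h₁
    obtain ⟨ε, hε, hball⟩ := Metric.eventually_nhds_iff_ball.1 hQ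
    rw [nhds_prod_eq, nhds_prod_eq]
    have hb : ∀ᶠ y in 𝓝 x, y ∈ Metric.ball x ε := Metric.ball_mem_nhds x hε
    filter_upwards [hP.prod_mk (hb.prod_mk hb)]
    rintro ⟨g, a, b⟩ ⟨hg, ha, hb⟩ hga hgb
    simp only at hg ha hb hga hgb ⊢
    -- By Rolle, two zeros of the curvature would enclose a zero of `curvDeriv`, which is excluded
    -- on the whole ball for every curve near `f`.
    have key : ∀ a ∈ Metric.ball x ε, ∀ b ∈ Metric.ball x ε, g.curv a = 0 → g.curv b = 0 →
        ¬ a < b := by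
      intro a ha b hb hga hgb hab
      obtain ⟨c, hc, hc'⟩ := exists_hasDerivAt_eq_zero hab g.continuous_curv.continuousOn
        (hga.trans hgb.symm) fun c _ => g.hasDerivAt_curv c
      refine hPQ hg (hball c ?_) hc'
      rw [Real.ball_eq_Ioo] at ha hb ⊢
      exact ⟨ha.1.trans hc.1, hc.2.trans hb.2⟩
    rcases lt_trichotomy a b with hab | hab | hab
    · exact absurd hab (key a ha b hb hga hgb)
    · exact hab
    · exact absurd hab (key b hb a ha hgb hga)
  · filter_upwards [continuous_eval_fst_curv.continuousAt.eventually_ne h₀] with p hp h₁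
    exact absurd h₁ hp

theorem eventually_inflexionsNotParallel_of_not_parallel {x y : ℝ}
    (h : ¬ (f.curv x = 0 ∧ f.curv y = 0 ∧ planeDet (f.d 1 x) (f.d 1 y) = 0)) :
    ∀ᶠ p : RegularClosedCurve × ℝ × ℝ in 𝓝 (f, x, y), p.1.InflexionsNotParallel p.2.1 p.2.2 := by
  by_cases h₁ : f.curv x = 0
  · by_cases h₂ : f.curv y = 0
    · have h₃ : planeDet (f.d 1 x) (f.d 1 y) ≠ 0 := fun h₃ => h ⟨h₁, h₂, h₃⟩
      filter_upwards [continuous_eval_planeDet.continuousAt.eventually_ne h₃] with p hp _ _ h'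
      exact absurd h' hp
    · filter_upwards [continuous_eval_snd_curv.continuousAt.eventually_ne h₂] with p hp _ h'
      exact absurd h' hp
  · filter_upwards [continuous_eval_fst_curv.continuousAt.eventually_ne h₁] with p hp h'
    exact absurd h' hp

theorem eventually_inflexionsNotParallel_of_eq {x y : ℝ} (h : f.curv x = 0 → f.curvDeriv x ≠ 0)
    {n : ℤ} (hn : y = x + n) :
    ∀ᶠ p : RegularClosedCurve × ℝ × ℝ in 𝓝 (f, x, y), p.1.InflexionsNotParallel p.2.1 p.2.2 := by
  have hT : Tendsto (fun p : RegularClosedCurve × ℝ × ℝ => (p.1, p.2.1, p.2.2 - (n : ℝ)))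
      (𝓝 (f, x, y)) (𝓝 (f, x, x)) := by
    have hc : Continuous fun p : RegularClosedCurve × ℝ × ℝ => (p.1, p.2.1, p.2.2 - (n : ℝ)) := by
      fun_prop
    have := hc.tendsto (f, x, y)
    simpa [hn] using this
  filter_upwards [hT.eventually (f.eventually_unique_zero_curv h)] with p hp h₁ h₂ _
  have h₃ : p.1.curv (p.2.2 - n) = 0 := by
    rw [← p.1.curv_add_int _ n, sub_add_cancel, h₂]
  have h₄ : p.2.1 = p.2.2 - n := hp h₁ h₃
  exact ⟨n, by linarith⟩

/-- The curves whose inflexion points are nondegenerate form an open set. -/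
theorem isOpen_hasSimpleInflexions : IsOpen {f : RegularClosedCurve | f.HasSimpleInflexions} := by
  rw [isOpen_iff_mem_nhds]
  intro f hf
  have h := isCompact_Icc.eventually_forall_of_forall_eventually (x₀ := f) (K := Icc (0 : ℝ) 1)
    (P := fun g x => g.curv x = 0 → g.curvDeriv x ≠ 0) fun x _ => by
      by_cases h₀ : f.curv x = 0
      · filter_upwards [continuous_eval_curvDeriv.continuousAt.eventually_ne
          (x := ((f, x) : RegularClosedCurve × ℝ)) (hf x h₀)] with p hp _
        exact hp
      · filter_upwards [continuous_eval_curv.continuousAt.eventually_ne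
          (x := ((f, x) : RegularClosedCurve × ℝ)) h₀] with p hp h'
        exact absurd h' hp
  filter_upwards [h] with g hg x
  have := hg (Int.fract x) ⟨Int.fract_nonneg x, (Int.fract_lt_one x).le⟩
  rwa [← g.curv_add_int _ ⌊x⌋, ← g.curvDeriv_add_int _ ⌊x⌋, Int.fract_add_floor] at this

theorem InflexionsNotParallel.of_fract {x y : ℝ}
    (h : f.InflexionsNotParallel (Int.fract x) (Int.fract y)) : f.InflexionsNotParallel x y := by
  intro h₁ h₂ h₃
  rw [← Int.fract_add_floor x] at h₁ h₃
  rw [← Int.fract_add_floor y] at h₂ h₃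
  rw [curv_add_int] at h₁ h₂
  rw [d_add_int, d_add_int] at h₃
  obtain ⟨n, hn⟩ := h h₁ h₂ h₃
  refine ⟨n + ⌊y⌋ - ⌊x⌋, ?_⟩
  push_cast
  linarith [Int.fract_add_floor x, Int.fract_add_floor y]

/-- The generic set: nondegenerate inflexion points, no two of which have parallel tangents. -/
def genericSet : Set RegularClosedCurve :=
  {f | f.HasSimpleInflexions ∧ ∀ x y, f.InflexionsNotParallel x y}

/-- Compactness of the unit square and periodicity turn local statements into a global one. The
family `F` and the side condition `R` allow two uses: all nearby curves for openness, and a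
one-parameter perturbation with `ε ≠ 0` for density. -/
theorem eventually_forall_inflexionsNotParallel {X : Type*} [TopologicalSpace X] {x₀ : X}
    {F : X → RegularClosedCurve} {R : X → Prop}
    (h : ∀ x y, ∀ᶠ p : X × ℝ × ℝ in 𝓝 (x₀, x, y),
      R p.1 → (F p.1).InflexionsNotParallel p.2.1 p.2.2) :
    ∀ᶠ c in 𝓝 x₀, R c → ∀ x y, (F c).InflexionsNotParallel x y := by
  have h' := (isCompact_Icc.prod isCompact_Icc).eventually_forall_of_forall_eventually (x₀ := x₀)
    (K := Icc (0 : ℝ) 1 ×ˢ Icc (0 : ℝ) 1)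
    (P := fun c q => R c → (F c).InflexionsNotParallel q.1 q.2) fun q _ => h q.1 q.2
  filter_upwards [h'] with c hc hR x y
  exact InflexionsNotParallel.of_fract _ (hc (Int.fract x, Int.fract y)
    ⟨⟨Int.fract_nonneg x, (Int.fract_lt_one x).le⟩, ⟨Int.fract_nonneg y, (Int.fract_lt_one y).le⟩⟩ hR)

theorem isOpen_genericSet : IsOpen genericSet := by
  rw [isOpen_iff_mem_nhds]
  rintro f ⟨hf, hf'⟩
  have h := eventually_forall_inflexionsNotParallel (x₀ := f) (F := id) (R := fun _ => True)
    fun x y => by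
      have : ∀ᶠ p : RegularClosedCurve × ℝ × ℝ in 𝓝 (f, x, y),
          p.1.InflexionsNotParallel p.2.1 p.2.2 := by
        by_cases h₀ : f.curv x = 0 ∧ f.curv y = 0 ∧ planeDet (f.d 1 x) (f.d 1 y) = 0
        · obtain ⟨n, hn⟩ := hf' x y h₀.1 h₀.2.1 h₀.2.2
          exact f.eventually_inflexionsNotParallel_of_eq (hf x) hn
        · exact f.eventually_inflexionsNotParallel_of_not_parallel h₀
      filter_upwards [this] with p hp _ using hp
  filter_upwards [h, isOpen_hasSimpleInflexions.mem_nhds hf] with g hg hg'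
  exact ⟨hg', hg trivial⟩

end RegularClosedCurve

/-! ### Perturbations of a curve by a linear family -/

theorem finite_zeros_of_deriv_ne_zero {g : ℝ → ℝ} (hg : Differentiable ℝ g) {a b : ℝ}
    (h : ∀ x ∈ Icc a b, g x = 0 → deriv g x ≠ 0) : {x ∈ Icc a b | g x = 0}.Finite := by
  by_contra hinf
  obtain ⟨z, hz, hacc⟩ := Set.Infinite.exists_accPt_of_subset_isCompact hinf isCompact_Icc
    fun x hx => hx.1
  have hfreq := (accPt_iff_frequently.1 hacc)
  have hz₀ : g z = 0 := by
    by_contra hne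
    refine hfreq ?_
    filter_upwards [hg.continuous.continuousAt.eventually_ne hne] with y hy hy'
    exact hy hy'.2.2
  have h₁ := (hg z).hasDerivAt.eventually_ne (c := 0) (h z hz hz₀)
  rw [eventually_nhdsWithin_iff] at h₁
  refine hfreq ?_
  filter_upwards [h₁] with y hy hy'
  exact hy hy'.1 hy'.2.2

theorem iteratedDeriv_add_clm_apply {V E : Type*} [NormedAddCommGroup V] [NormedSpace ℝ V]
    [NormedAddCommGroup E] [NormedSpace ℝ E] {g : ℝ → E} {q : ℝ → V →L[ℝ] E}
    (hg : ContDiff ℝ ∞ g) (hq : ContDiff ℝ ∞ q) (c : V) (k : ℕ) :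
    iteratedDeriv k (fun x => g x + q x c) = fun x => iteratedDeriv k g x + iteratedDeriv k q x c := by
  induction k with
  | zero => simp
  | succ k ih =>
    rw [iteratedDeriv_succ, ih]
    funext x
    have h := (hg.hasDerivAt_iteratedDeriv k x).add
      ((hq.hasDerivAt_iteratedDeriv k x).clm_apply (hasDerivAt_const x c))
    rw [map_zero, add_zero] at h
    exact h.deriv

namespace RegularClosedCurve

variable (f : RegularClosedCurve)

/-- Periodicity bounds each derivative of `q` uniformly, so a small `c` changes every derivative of
the curve uniformly little. Once the change of velocity is below the minimal speed of `f`, the curve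
stays regular; for other `c` the family may take the default value `f`. -/
theorem exists_perturbation {V : Type*} [NormedAddCommGroup V] [NormedSpace ℝ V]
    {q : ℝ → V →L[ℝ] Plane} (hq : ContDiff ℝ ∞ q) (hp : Function.Periodic q 1) :
    ∃ F : V → RegularClosedCurve, Tendsto F (𝓝 0) (𝓝 f) ∧
      ∀ᶠ c in 𝓝 0, ∀ k x, (F c).d k x = f.d k x + iteratedDeriv k q x c := by
  classical
  have hbound : ∀ k, ∃ M, ∀ x, ‖iteratedDeriv k q x‖ ≤ M := fun k =>
    (hp.iteratedDeriv k).bounded_of_continuous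
      (continuous_iff_continuousAt.2 fun x => (hq.hasDerivAt_iteratedDeriv k x).continuousAt)
  have hsmall : ∀ k, ∀ ε > 0, ∀ᶠ c : V in 𝓝 0, ∀ x, ‖iteratedDeriv k q x c‖ < ε := by
    intro k ε hε
    obtain ⟨M, hM⟩ := hbound k
    have hM₀ : 0 ≤ M := (norm_nonneg _).trans (hM 0)
    filter_upwards [Metric.ball_mem_nhds (0 : V) (show 0 < ε / (M + 1) by positivity)] with c hc x
    rw [mem_ball_zero_iff, lt_div_iff₀ (by positivity)] at hc
    calc ‖iteratedDeriv k q x c‖ ≤ ‖iteratedDeriv k q x‖ * ‖c‖ := ContinuousLinearMap.le_opNorm _ _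
      _ ≤ M * ‖c‖ := by gcongr; exact hM x
      _ ≤ ‖c‖ * (M + 1) := by nlinarith [norm_nonneg c]
      _ < ε := hc
  have hreg : ∀ᶠ c : V in 𝓝 0, ∀ x, deriv (fun x => f x + q x c) x ≠ 0 := by
    obtain ⟨x₀, -, hx₀⟩ := isCompact_Icc.exists_isMinOn (s := Icc (0 : ℝ) 1)
      (nonempty_Icc.2 zero_le_one) (f.continuous_d 1).norm.continuousOn
    filter_upwards [hsmall 1 ‖f.d 1 x₀‖ (norm_pos_iff.2 (f.d_one_ne_zero x₀))] with c hc x h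
    have h₁ := congrFun (iteratedDeriv_add_clm_apply f.smooth hq c 1) x
    rw [iteratedDeriv_one, h] at h₁
    have h₂ : ‖f.d 1 x₀‖ ≤ ‖f.d 1 x‖ := by
      have := hx₀ (show Int.fract x ∈ Icc (0 : ℝ) 1 from
        ⟨Int.fract_nonneg x, (Int.fract_lt_one x).le⟩)
      simp only [mem_ofPred_eq] at this
      rwa [← f.d_add_int 1 (Int.fract x) ⌊x⌋, Int.fract_add_floor] at this
    have h₃ : f.d 1 x = -iteratedDeriv 1 q x c := eq_neg_of_add_eq_zero_left h₁.symm
    rw [h₃, norm_neg] at h₂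
    exact (hc x).not_ge h₂
  let F : V → RegularClosedCurve := fun c =>
    if h : ∀ x, deriv (fun x => f x + q x c) x ≠ 0 then
      { toFun := fun x => f x + q x c
        smooth := f.smooth.add (hq.clm_apply contDiff_const)
        periodic := fun x => by simp only [f.periodic x, hp x]
        regular := h }
    else f
  have hF : ∀ᶠ c in 𝓝 0, ∀ k x, (F c).d k x = f.d k x + iteratedDeriv k q x c := by
    filter_upwards [hreg] with c hc k x
    simp only [F, dif_pos hc, d]
    exact congrFun (iteratedDeriv_add_clm_apply f.smooth hq c k) x
  refine ⟨F, ?_, hF⟩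
  rw [tendsto_nhds_iff]
  intro k
  rw [Metric.tendstoUniformly_iff]
  intro ε hε
  filter_upwards [hF, hsmall k ε hε] with c hc hc' x
  rw [hc k x, dist_self_add_right]
  exact hc' x

end RegularClosedCurve

/-! ### Density of nondegenerate inflexions by trigonometric perturbation -/

/-- The trigonometric polynomial of degree two with coefficients `a`, `b`, `c`, `e` and zero mean. -/
noncomputable def trigPoly {E : Type*} [NormedAddCommGroup E] [NormedSpace ℝ E] (a b c e : E)
    (x : ℝ) : E :=
  Real.cos (2 * Real.pi * x) • a + Real.sin (2 * Real.pi * x) • b +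
    (Real.cos (4 * Real.pi * x) • c + Real.sin (4 * Real.pi * x) • e)

section TrigPoly

variable {E : Type*} [NormedAddCommGroup E] [NormedSpace ℝ E]

theorem contDiff_trigPoly (a b c e : E) : ContDiff ℝ ∞ (trigPoly a b c e) := by
  unfold trigPoly; fun_prop

theorem periodic_trigPoly (a b c e : E) : Function.Periodic (trigPoly a b c e) 1 := by
  intro x
  have h₁ : 2 * Real.pi * (x + 1) = 2 * Real.pi * x + 2 * Real.pi := by ring
  have h₂ : 4 * Real.pi * (x + 1) = 4 * Real.pi * x + 2 * Real.pi + 2 * Real.pi := by ring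
  simp only [trigPoly, h₁, h₂, Real.cos_add_two_pi, Real.sin_add_two_pi]

theorem hasDerivAt_trigPoly (a b c e : E) (x : ℝ) :
    HasDerivAt (trigPoly a b c e) (trigPoly ((2 * Real.pi) • b) (-((2 * Real.pi) • a))
      ((4 * Real.pi) • e) (-((4 * Real.pi) • c)) x) x := by
  have h₁ : HasDerivAt (fun x : ℝ => 2 * Real.pi * x) (2 * Real.pi) x := by
    simpa using (hasDerivAt_id x).const_mul (2 * Real.pi)
  have h₂ : HasDerivAt (fun x : ℝ => 4 * Real.pi * x) (4 * Real.pi) x := by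
    simpa using (hasDerivAt_id x).const_mul (4 * Real.pi)
  have := ((h₁.cos.smul_const a).add (h₁.sin.smul_const b)).add
    ((h₂.cos.smul_const c).add (h₂.sin.smul_const e))
  refine this.congr_deriv ?_
  simp only [trigPoly]
  module

theorem deriv_trigPoly (a b c e : E) :
    deriv (trigPoly a b c e) = trigPoly ((2 * Real.pi) • b) (-((2 * Real.pi) • a))
      ((4 * Real.pi) • e) (-((4 * Real.pi) • c)) :=
  funext fun x => (hasDerivAt_trigPoly a b c e x).deriv

end TrigPoly

section TrigPerturbation

open ContinuousLinearMap in
/-- The universal trigonometric polynomial of degree two with zero mean and values in the plane. -/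
noncomputable def trigFamily : ℝ → (Plane × Plane × Plane × Plane) →L[ℝ] Plane :=
  trigPoly (fst ℝ _ _) ((fst ℝ _ _).comp (snd ℝ _ _)) ((fst ℝ _ _).comp ((snd ℝ _ _).comp (snd ℝ _ _)))
    ((snd ℝ _ _).comp ((snd ℝ _ _).comp (snd ℝ _ _)))

theorem iteratedDeriv_one_trigFamily (x : ℝ) (a b c e : Plane) :
    iteratedDeriv 1 trigFamily x (a, b, c, e) =
      (2 * Real.pi) • (-(Real.sin (2 * Real.pi * x) • a) + Real.cos (2 * Real.pi * x) • b) +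
      (4 * Real.pi) • (-(Real.sin (4 * Real.pi * x) • c) + Real.cos (4 * Real.pi * x) • e) := by
  rw [iteratedDeriv_one, trigFamily, deriv_trigPoly]
  simp [trigPoly]
  module

theorem iteratedDeriv_two_trigFamily (x : ℝ) (a b c e : Plane) :
    iteratedDeriv 2 trigFamily x (a, b, c, e) =
      -((2 * Real.pi) ^ 2 • (Real.cos (2 * Real.pi * x) • a + Real.sin (2 * Real.pi * x) • b)) -
      (4 * Real.pi) ^ 2 • (Real.cos (4 * Real.pi * x) • c + Real.sin (4 * Real.pi * x) • e) := by
  rw [iteratedDeriv_succ, iteratedDeriv_one, trigFamily, deriv_trigPoly, deriv_trigPoly]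
  simp [trigPoly]
  module

theorem iteratedDeriv_three_trigFamily (x : ℝ) (a b c e : Plane) :
    iteratedDeriv 3 trigFamily x (a, b, c, e) =
      -((2 * Real.pi) ^ 3 • (-(Real.sin (2 * Real.pi * x) • a) + Real.cos (2 * Real.pi * x) • b)) -
      (4 * Real.pi) ^ 3 • (-(Real.sin (4 * Real.pi * x) • c) + Real.cos (4 * Real.pi * x) • e) := by
  rw [iteratedDeriv_succ, iteratedDeriv_succ, iteratedDeriv_one, trigFamily, deriv_trigPoly,
    deriv_trigPoly, deriv_trigPoly]
  simp [trigPoly]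
  module

end TrigPerturbation

namespace RegularClosedCurve

variable (f : RegularClosedCurve)

/-- The trigonometric perturbation of degree two with derivatives `u - f'`, `α u - f''`, `β u - f'''`
at the point `x`; its remaining degrees of freedom are parametrized by `e`. -/
noncomputable def degeneratePerturbation (p : ℝ × Plane × ℝ × ℝ × Plane) :
    Plane × Plane × Plane × Plane :=
  let x := p.1
  let u := p.2.1
  let α := p.2.2.1
  let β := p.2.2.2.1
  let e := p.2.2.2.2
  let w := 2 * Real.pi
  -- In coefficients rotated to the base point `x`, the perturbation `q` satisfies `q' = w a' + 2w
  -- c'`, `q'' = -w² b' - 4w² e` and `q''' = -w³ a' - 8w³ c'`. Hence `q''' + w² q' = -6w³ c'`, which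
  -- gives `c'`, then `a'` and `b'`; the last four entries undo the rotation.
  let c' := -((1 / (6 * w ^ 3)) • ((β • u - f.d 3 x) + w ^ 2 • (u - f.d 1 x)))
  let a' := (1 / w) • (u - f.d 1 x) - (2 : ℝ) • c'
  let b' := -((1 / w ^ 2) • (α • u - f.d 2 x)) - (4 : ℝ) • e
  (Real.cos (2 * Real.pi * x) • b' - Real.sin (2 * Real.pi * x) • a',
    Real.sin (2 * Real.pi * x) • b' + Real.cos (2 * Real.pi * x) • a',
    Real.cos (4 * Real.pi * x) • e - Real.sin (4 * Real.pi * x) • c',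
    Real.sin (4 * Real.pi * x) • e + Real.cos (4 * Real.pi * x) • c')

theorem contDiff_d (k : ℕ) : ContDiff ℝ ∞ (f.d k) := by
  have : ∀ k, ContDiff ℝ ∞ (iteratedDeriv k f.toFun) := by
    intro k
    induction k with
    | zero => simpa using f.smooth
    | succ k ih => rw [iteratedDeriv_succ]; exact (contDiff_infty_iff_deriv.1 ih).2
  exact this k

theorem contDiff_degeneratePerturbation : ContDiff ℝ 1 f.degeneratePerturbation := by
  have h : ∀ k, ContDiff ℝ 1 (f.d k) := fun k => (f.contDiff_d k).of_le (by simp)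
  have h₁ := h 1
  have h₂ := h 2
  have h₃ := h 3
  unfold degeneratePerturbation
  fun_prop

/-- A degenerate inflexion means that the second and third derivatives are multiples `α u`, `β u` of
the velocity `u`. So a perturbation producing one is recovered from `x`, `u`, `α`, `β` and one free
plane vector. -/
theorem mem_range_degeneratePerturbation {x α β : ℝ} {a b c e : Plane}
    (h₂ : f.d 2 x + iteratedDeriv 2 trigFamily x (a, b, c, e) =
      α • (f.d 1 x + iteratedDeriv 1 trigFamily x (a, b, c, e)))
    (h₃ : f.d 3 x + iteratedDeriv 3 trigFamily x (a, b, c, e) =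
      β • (f.d 1 x + iteratedDeriv 1 trigFamily x (a, b, c, e))) :
    (a, b, c, e) ∈ range f.degeneratePerturbation := by
  refine ⟨(x, f.d 1 x + iteratedDeriv 1 trigFamily x (a, b, c, e), α, β,
    Real.cos (4 * Real.pi * x) • c + Real.sin (4 * Real.pi * x) • e), ?_⟩
  have hs := Real.cos_sq_add_sin_sq (2 * Real.pi * x)
  have hs' := Real.cos_sq_add_sin_sq (4 * Real.pi * x)
  have hpi := Real.pi_ne_zero
  simp only [degeneratePerturbation, ← h₂, ← h₃, add_sub_cancel_left]
  rw [iteratedDeriv_one_trigFamily, iteratedDeriv_two_trigFamily, iteratedDeriv_three_trigFamily]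
  generalize Real.cos (2 * Real.pi * x) = C at *
  generalize Real.sin (2 * Real.pi * x) = S at *
  generalize Real.cos (4 * Real.pi * x) = C' at *
  generalize Real.sin (4 * Real.pi * x) = S' at *
  generalize Real.pi = w at *
  simp only [Prod.mk.injEq]
  refine ⟨?_, ?_, ?_, ?_⟩ <;> match_scalars <;> field_simp <;> first
    | linear_combination 6 * hs
    | linear_combination 48 * hs'
    | ring

theorem dense_hasSimpleInflexions : Dense {f : RegularClosedCurve | f.HasSimpleInflexions} := by
  intro f
  rw [mem_closure_iff_nhds]
  intro U hU
  obtain ⟨F, hF, hFd⟩ := f.exists_perturbation (q := trigFamily) (contDiff_trigPoly _ _ _ _)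
    (periodic_trigPoly _ _ _ _)
  have hdense : Dense (range f.degeneratePerturbation)ᶜ := by
    -- The dimensions are `1 + 2 + 1 + 1 + 2 = 7` for the source and `4 · 2 = 8` for the target.
    refine f.contDiff_degeneratePerturbation.dense_compl_range_of_finrank_lt_finrank ?_
    simp
  obtain ⟨c, ⟨hcU, hcd⟩, hc⟩ := mem_closure_iff_nhds.1 (hdense 0) _
    ((hF.eventually hU).and hFd)
  refine ⟨F c, hcU, fun x hx hx' => hc ?_⟩
  obtain ⟨a, b, c, e⟩ := c
  obtain ⟨α, hα⟩ := exists_smul_of_planeDet_eq_zero ((F (a, b, c, e)).d_one_ne_zero x) hx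
  obtain ⟨β, hβ⟩ := exists_smul_of_planeDet_eq_zero ((F (a, b, c, e)).d_one_ne_zero x) hx'
  rw [hcd, hcd] at hα hβ
  exact f.mem_range_degeneratePerturbation hα hβ

end RegularClosedCurve

/-! ### Separating the tangent directions at the inflexion points -/

theorem exists_cos_separating {Z : Set ℝ} (hZ : Z.Countable) :
    ∃ a : ℝ, ∀ x ∈ Z, ∀ y ∈ Z,
      Real.cos (2 * Real.pi * (x - a)) = Real.cos (2 * Real.pi * (y - a)) → ∃ n : ℤ, y = x + n := by
  -- These are the centres about which some `x` and `y` are mirror images modulo `1`, the only way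
  -- for the cosine to identify incongruent points.
  let B : Set ℝ := ⋃ x ∈ Z, ⋃ y ∈ Z, range fun n : ℤ => (x + y - n) / 2
  have hB : B.Countable := hZ.biUnion fun x _ => hZ.biUnion fun y _ => countable_range _
  obtain ⟨a, ha⟩ : ∃ a, a ∉ B := by
    by_contra! h
    exact not_countable_univ (hB.mono fun x _ => h x : (univ : Set ℝ).Countable)
  refine ⟨a, fun x hx y hy h => ?_⟩
  have hpi : 2 * Real.pi ≠ 0 := by positivity
  obtain ⟨k, hk | hk⟩ := Real.cos_eq_cos_iff.1 h
  · refine ⟨k, ?_⟩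
    apply mul_left_cancel₀ hpi
    linear_combination hk
  · refine absurd ?_ ha
    refine mem_biUnion hx (mem_biUnion hy ⟨k, ?_⟩)
    have : 2 * a = x + y - k := by
      apply mul_left_cancel₀ hpi
      linear_combination -hk
    simp only
    linarith

theorem exists_periodic_separating {Z : Set ℝ} (hZ : Z.Finite) :
    ∃ η : ℝ → ℝ, ContDiff ℝ ∞ η ∧ Function.Periodic η 1 ∧
      (∀ x ∈ Z, deriv η x = 0 ∧ deriv (deriv η) x = 0) ∧
      ∀ x ∈ Z, ∀ y ∈ Z, η x = η y → ∃ n : ℤ, y = x + n := by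
  suffices h : ∀ W : Set ℝ, W.Finite → ∃ η : ℝ → ℝ, ContDiff ℝ ∞ η ∧ Function.Periodic η 1 ∧
      (∀ x ∈ W, deriv η x = 0 ∧ deriv (deriv η) x = 0) ∧
      ∀ x ∈ Z, ∀ y ∈ Z, η x = η y → ∃ n : ℤ, y = x + n from h Z hZ
  intro W hW
  induction W, hW using Set.Finite.induction_on with
  | empty =>
    obtain ⟨a, ha⟩ := exists_cos_separating hZ.countable
    refine ⟨fun x => Real.cos (2 * Real.pi * (x - a)), by fun_prop, fun x => ?_, by simp, ha⟩
    have : 2 * Real.pi * (x + 1 - a) = 2 * Real.pi * (x - a) + 2 * Real.pi := by ring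
    simp only [this, Real.cos_add_two_pi]
  | @insert v W _ _ ih =>
    obtain ⟨η, hη, hper, hzero, hsep⟩ := ih
    have hd : Differentiable ℝ η := hη.differentiable (by simp)
    have hd' : Differentiable ℝ (deriv η) :=
      (contDiff_infty_iff_deriv.1 hη).2.differentiable (by simp)
    have h₁ : deriv (fun x => (η x - η v) ^ 3) = fun x => 3 * (η x - η v) ^ 2 * deriv η x := by
      funext x
      refine ((((hd x).hasDerivAt.sub_const (η v)).pow 3).congr_deriv ?_).deriv
      norm_num
    have h₂ : ∀ x, deriv (deriv fun x => (η x - η v) ^ 3) x =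
        6 * (η x - η v) * deriv η x * deriv η x + 3 * (η x - η v) ^ 2 * deriv (deriv η) x := by
      intro x
      rw [h₁]
      have := (((((hd x).hasDerivAt.sub_const (η v)).pow 2).const_mul 3).mul
        (hd' x).hasDerivAt)
      refine (this.congr_deriv ?_).deriv
      simp only [Nat.cast_ofNat, Nat.add_one_sub_one, Pi.pow_apply]
      ring
    -- Cubing kills the first two derivatives at `v` and keeps those already killed elsewhere; being
    -- injective, it does not spoil the separation.
    refine ⟨fun x => (η x - η v) ^ 3, by fun_prop, fun x => by simp only [hper x], ?_, ?_⟩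
    · intro x hx
      rw [h₂, h₁]
      rcases hx with rfl | hx
      · simp
      · simp [(hzero x hx).1, (hzero x hx).2]
    · intro x hx y hy h
      refine hsep x hx y hy ?_
      have h₃ : η x - η v = η y - η v := (Odd.strictMono_pow (by decide : Odd 3)).injective h
      linarith

/-- The rotation of the plane by a right angle. -/
noncomputable def planeRot : Plane →L[ℝ] Plane :=
  LinearMap.toContinuousLinearMap
    { toFun := fun u => !₂[-u 1, u 0]
      map_add' := fun u v => by ext i; fin_cases i <;> simp [add_comm]
      map_smul' := fun r u => by ext i; fin_cases i <;> simp }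

theorem planeRot_apply_zero (u : Plane) : planeRot u 0 = -u 1 := rfl

theorem planeRot_apply_one (u : Plane) : planeRot u 1 = u 0 := rfl

theorem planeDet_add_smul_planeRot (r : ℝ) (u v : Plane) :
    planeDet (u + r • planeRot u) (v + r • planeRot v) = (1 + r ^ 2) * planeDet u v := by
  simp [planeDet, planeRot_apply_zero, planeRot_apply_one]; ring

theorem planeDet_add_smul_planeRot_smul (r₁ r₂ t : ℝ) (u : Plane) :
    planeDet (u + r₁ • planeRot u) (t • u + r₂ • planeRot (t • u)) =
      t * (r₂ - r₁) * planeSq u := by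
  simp [planeDet, planeSq, planeRot_apply_zero, planeRot_apply_one]; ring

namespace RegularClosedCurve

variable (f : RegularClosedCurve)

/-- The perturbation direction which turns the curve with angular speed `η`. -/
noncomputable def turningField (η : ℝ → ℝ) (x : ℝ) : ℝ →L[ℝ] Plane :=
  (ContinuousLinearMap.lsmul ℝ ℝ : ℝ →L[ℝ] Plane →L[ℝ] Plane).flip (η x • planeRot (f x))

theorem contDiff_turningField {η : ℝ → ℝ} (hη : ContDiff ℝ ∞ η) :
    ContDiff ℝ ∞ (f.turningField η) := by
  have := f.smooth
  unfold turningField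
  fun_prop

theorem periodic_turningField {η : ℝ → ℝ} (hη : Function.Periodic η 1) :
    Function.Periodic (f.turningField η) 1 := fun x => by
  simp only [turningField, hη x, f.periodic x]

theorem iteratedDeriv_turningField {η : ℝ → ℝ} (hη : ContDiff ℝ ∞ η) {x : ℝ}
    (h₁ : deriv η x = 0) (h₂ : deriv (deriv η) x = 0) (ε : ℝ) :
    iteratedDeriv 1 (f.turningField η) x ε = (ε * η x) • planeRot (f.d 1 x) ∧
      iteratedDeriv 2 (f.turningField η) x ε = (ε * η x) • planeRot (f.d 2 x) := by
  have hd : Differentiable ℝ η := hη.differentiable (by simp)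
  have hd' : Differentiable ℝ (deriv η) :=
    (contDiff_infty_iff_deriv.1 hη).2.differentiable (by simp)
  have hf : ∀ x, HasDerivAt (fun x => planeRot (f x)) (planeRot (f.d 1 x)) x := fun x => by
    have := f.hasDerivAt_d 0 x
    simp only [d, iteratedDeriv_zero] at this
    exact planeRot.hasFDerivAt.comp_hasDerivAt x this
  have hf' : ∀ x, HasDerivAt (fun x => planeRot (f.d 1 x)) (planeRot (f.d 2 x)) x := fun x =>
    planeRot.hasFDerivAt.comp_hasDerivAt x (f.hasDerivAt_d 1 x)
  have k₁ : deriv (f.turningField η) = fun x =>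
      (ContinuousLinearMap.lsmul ℝ ℝ : ℝ →L[ℝ] Plane →L[ℝ] Plane).flip
        (η x • planeRot (f.d 1 x) + deriv η x • planeRot (f x)) := by
    funext x
    exact (((ContinuousLinearMap.lsmul ℝ ℝ : ℝ →L[ℝ] Plane →L[ℝ] Plane).flip).hasFDerivAt.comp_hasDerivAt
      x ((hd x).hasDerivAt.smul (hf x))).deriv
  have k₂ : deriv (deriv (f.turningField η)) x =
      (ContinuousLinearMap.lsmul ℝ ℝ : ℝ →L[ℝ] Plane →L[ℝ] Plane).flip
        ((η x • planeRot (f.d 2 x) + deriv η x • planeRot (f.d 1 x)) +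
          (deriv η x • planeRot (f.d 1 x) + deriv (deriv η) x • planeRot (f x))) := by
    rw [k₁]
    exact (((ContinuousLinearMap.lsmul ℝ ℝ : ℝ →L[ℝ] Plane →L[ℝ] Plane).flip).hasFDerivAt.comp_hasDerivAt
      x (((hd x).hasDerivAt.smul (hf' x)).add ((hd' x).hasDerivAt.smul (hf x)))).deriv
  rw [iteratedDeriv_succ (n := 1), iteratedDeriv_one, k₂, k₁]
  simp [h₁, h₂, mul_smul, smul_comm (η x) ε]

theorem finite_zeros_curv (hf : f.HasSimpleInflexions) : {x ∈ Icc (0 : ℝ) 1 | f.curv x = 0}.Finite :=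
  finite_zeros_of_deriv_ne_zero (fun x => (f.hasDerivAt_curv x).differentiableAt) fun x _ hx => by
    rw [(f.hasDerivAt_curv x).deriv]
    exact hf x hx

theorem exists_separating (hf : f.HasSimpleInflexions) :
    ∃ η : ℝ → ℝ, ContDiff ℝ ∞ η ∧ Function.Periodic η 1 ∧
      (∀ x, f.curv x = 0 → deriv η x = 0 ∧ deriv (deriv η) x = 0) ∧
      ∀ x y, f.curv x = 0 → f.curv y = 0 → η x = η y → ∃ n : ℤ, y = x + n := by
  obtain ⟨η, hη, hper, hzero, hsep⟩ := exists_periodic_separating (f.finite_zeros_curv hf)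
  have hmem : ∀ x, f.curv x = 0 → Int.fract x ∈ {x ∈ Icc (0 : ℝ) 1 | f.curv x = 0} := fun x hx =>
    ⟨⟨Int.fract_nonneg x, (Int.fract_lt_one x).le⟩, by
      rwa [← f.curv_add_int _ ⌊x⌋, Int.fract_add_floor]⟩
  have hfract : ∀ g : ℝ → ℝ, Function.Periodic g 1 → ∀ x, g (Int.fract x) = g x := fun g hg x => by
    have := hg.int_mul ⌊x⌋ (Int.fract x)
    rw [mul_one, Int.fract_add_floor] at this
    exact this.symm
  have hper₁ : Function.Periodic (deriv η) 1 := by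
    simpa [iteratedDeriv_one] using hper.iteratedDeriv 1
  have hper₂ : Function.Periodic (deriv (deriv η)) 1 := by
    simpa [iteratedDeriv_one] using hper₁.iteratedDeriv 1
  refine ⟨η, hη, hper, fun x hx => ?_, fun x y hx hy h => ?_⟩
  · rw [← hfract _ hper₁ x, ← hfract _ hper₂ x]
    exact hzero _ (hmem x hx)
  · rw [← hfract _ hper x, ← hfract _ hper y] at h
    obtain ⟨n, hn⟩ := hsep _ (hmem x hx) _ (hmem y hy) h
    refine ⟨n + ⌊y⌋ - ⌊x⌋, ?_⟩
    push_cast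
    linarith [Int.fract_add_floor x, Int.fract_add_floor y]

/-- Since `η' = η'' = 0` at the inflexions, the perturbation acts on `f'` and `f''` there by the
same map `1 + ε η(x) J`, with `J` the right-angle rotation. This scales the determinant, so the
inflexions persist, while parallel tangents at inflexions with different `η` cease to be parallel.
-/
theorem mem_closure_genericSet (hf : f.HasSimpleInflexions) : f ∈ closure genericSet := by
  rw [mem_closure_iff_nhds]
  intro U hU
  obtain ⟨η, hη, hper, hzero, hsep⟩ := f.exists_separating hf
  obtain ⟨F, hF, hFd⟩ := f.exists_perturbation (f.contDiff_turningField hη)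
    (f.periodic_turningField hper)
  have hd : ∀ᶠ ε in 𝓝 0, ∀ x, f.curv x = 0 → (F ε).d 1 x = f.d 1 x + (ε * η x) • planeRot (f.d 1 x) ∧
      (F ε).d 2 x = f.d 2 x + (ε * η x) • planeRot (f.d 2 x) := by
    filter_upwards [hFd] with ε hε x hx
    rw [hε, hε]
    obtain ⟨h₁, h₂⟩ := f.iteratedDeriv_turningField hη (hzero x hx).1 (hzero x hx).2 ε
    rw [h₁, h₂]
    exact ⟨rfl, rfl⟩
  have hzeros : ∀ᶠ ε in 𝓝 0, ∀ x, f.curv x = 0 → (F ε).curv x = 0 := by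
    filter_upwards [hd] with ε hε x hx
    rw [curv, (hε x hx).1, (hε x hx).2, planeDet_add_smul_planeRot]
    exact mul_eq_zero_of_right _ hx
  have hlift : ∀ {x y : ℝ}, Tendsto (fun p : ℝ × ℝ × ℝ => (F p.1, p.2.1, p.2.2)) (𝓝 (0, x, y))
      (𝓝 (f, x, y)) := by
    intro x y
    rw [nhds_prod_eq, nhds_prod_eq (x := f)]
    exact hF.prodMap tendsto_id
  have hne : ∀ᶠ ε in 𝓝 (0 : ℝ), ε ≠ 0 → ∀ x y, (F ε).InflexionsNotParallel x y := by
    refine eventually_forall_inflexionsNotParallel fun x y => ?_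
    by_cases h₀ : f.curv x = 0 ∧ f.curv y = 0 ∧ planeDet (f.d 1 x) (f.d 1 y) = 0
    · by_cases hn : ∃ n : ℤ, y = x + n
      · obtain ⟨n, hn⟩ := hn
        filter_upwards [hlift.eventually (f.eventually_inflexionsNotParallel_of_eq (hf x) hn)]
          with p hp _ using hp
      · obtain ⟨hx, hy, hxy⟩ := h₀
        -- The old inflexion `x` persists and nearby zeros of the curvature are unique, so the
        -- perturbed curve has no other inflexion near `x`.
        have hX : ∀ᶠ p : ℝ × ℝ × ℝ in 𝓝 (0, x, y), (F p.1).curv p.2.1 = 0 →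
            (F p.1).curv x = 0 → p.2.1 = x := by
          have hT : Tendsto (fun p : ℝ × ℝ × ℝ => (p.1, p.2.1, x)) (𝓝 (0, x, y)) (𝓝 (0, x, x)) :=
            Continuous.tendsto' (by fun_prop) _ _ rfl
          filter_upwards [(hlift.comp hT).eventually (f.eventually_unique_zero_curv (hf x))]
            with p hp using hp
        have hY : ∀ᶠ p : ℝ × ℝ × ℝ in 𝓝 (0, x, y), (F p.1).curv p.2.2 = 0 →
            (F p.1).curv y = 0 → p.2.2 = y := by
          have hT : Tendsto (fun p : ℝ × ℝ × ℝ => (p.1, p.2.2, y)) (𝓝 (0, x, y)) (𝓝 (0, y, y)) :=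
            Continuous.tendsto' (by fun_prop) _ _ rfl
          filter_upwards [(hlift.comp hT).eventually (f.eventually_unique_zero_curv (hf y))]
            with p hp using hp
        filter_upwards [hX, hY, (continuous_fst.tendsto ((0 : ℝ), x, y)).eventually (hzeros.and hd)]
          with p hpX hpY hp hε h₁ h₂ h₃
        rw [hpX h₁ (hp.1 x hx), hpY h₂ (hp.1 y hy), (hp.2 x hx).1, (hp.2 y hy).1] at h₃
        obtain ⟨t, ht⟩ := exists_smul_of_planeDet_eq_zero (f.d_one_ne_zero x) hxy
        have ht₀ : t ≠ 0 := by
          rintro rfl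
          exact f.d_one_ne_zero y (by rw [ht, zero_smul])
        rw [ht, planeDet_add_smul_planeRot_smul] at h₃
        have hη₀ : p.1 * η y - p.1 * η x = 0 := by
          simpa [ht₀, (planeSq_pos (f.d_one_ne_zero x)).ne'] using h₃
        refine absurd (hsep x y hx hy ?_) hn
        apply mul_left_cancel₀ hε
        linarith
    · filter_upwards [hlift.eventually (f.eventually_inflexionsNotParallel_of_not_parallel h₀)]
        with p hp _ using hp
  have hall : ∀ᶠ ε in 𝓝[≠] (0 : ℝ), F ε ∈ U ∩ genericSet := by
    rw [eventually_nhdsWithin_iff]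
    filter_upwards [hne, hF.eventually hU, hF.eventually (isOpen_hasSimpleInflexions.mem_nhds hf)]
      with ε h₁ h₂ h₃ hε
    exact ⟨h₂, h₃, h₁ hε⟩
  obtain ⟨ε, hε⟩ := hall.exists
  exact ⟨F ε, hε⟩

theorem dense_genericSet : Dense genericSet :=
  dense_closure.1 (dense_hasSimpleInflexions.mono fun f hf => f.mem_closure_genericSet hf)

end RegularClosedCurve

/-! ### Parity of the number of simple zeros -/

theorem mul_pos_of_forall_ne_zero {g : ℝ → ℝ} (hg : Continuous g) {a b : ℝ} (hab : a ≤ b)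
    (h : ∀ x ∈ Icc a b, g x ≠ 0) : 0 < g a * g b := by
  have ha := h a (left_mem_Icc.2 hab)
  have hb := h b (right_mem_Icc.2 hab)
  by_contra hneg
  have h₀ : (0 : ℝ) ∈ uIcc (g a) (g b) := by
    rw [mem_uIcc]
    rcases lt_or_gt_of_ne ha with ha | ha <;> rcases lt_or_gt_of_ne hb with hb | hb
    · exact absurd (mul_pos_of_neg_of_neg ha hb) hneg
    · exact Or.inl ⟨ha.le, hb.le⟩
    · exact Or.inr ⟨hb.le, ha.le⟩
    · exact absurd (mul_pos ha hb) hneg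
  obtain ⟨x, hx, hx₀⟩ := intermediate_value_uIcc hg.continuousOn h₀
  rw [uIcc_of_le hab] at hx
  exact h x hx hx₀

theorem eventually_mul_pos_of_hasDerivAt {g : ℝ → ℝ} {g' z : ℝ} (h : HasDerivAt g g' z)
    (hz : g z = 0) (hg' : g' ≠ 0) : ∀ᶠ x in 𝓝[≠] z, 0 < g' * (g x * (x - z)) := by
  have h₁ := (hasDerivAt_iff_tendsto_slope.1 h).const_mul g'
  filter_upwards [h₁.eventually (lt_mem_nhds (mul_self_pos.2 hg')), self_mem_nhdsWithin] with x hx hxz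
  have hxz' : x - z ≠ 0 := sub_ne_zero.2 hxz
  have : g' * (g x * (x - z)) = g' * slope g z x * ((x - z) * (x - z)) := by
    rw [slope_def_field, hz]; field_simp; ring
  rw [this]
  exact mul_pos hx (mul_self_pos.2 hxz')

/-- Each simple zero flips the sign. The induction removes the largest zero `z` and moves the right
end to a point `b'` just left of `z` and beyond all other zeros. -/
theorem even_card_zeros_iff {g : ℝ → ℝ} (hg : Differentiable ℝ g) {a : ℝ} (ha : g a ≠ 0)
    (Z : Finset ℝ) : ∀ b, a < b → g b ≠ 0 → (∀ x, x ∈ Z ↔ x ∈ Ioo a b ∧ g x = 0) →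
      (∀ x ∈ Z, deriv g x ≠ 0) → (Even Z.card ↔ 0 < g a * g b) := by
  induction Z using Finset.induction_on_max with
  | empty =>
    intro b hab hb hZ _
    simp only [Finset.card_empty, Even.zero, true_iff]
    refine mul_pos_of_forall_ne_zero hg.continuous hab.le fun x hx hx₀ => ?_
    rcases eq_or_lt_of_le hx.1 with rfl | h₁
    · exact ha hx₀
    rcases eq_or_lt_of_le hx.2 with rfl | h₂
    · exact hb hx₀
    exact Finset.notMem_empty x ((hZ x).2 ⟨⟨h₁, h₂⟩, hx₀⟩)
  | insert z Z hmax ih =>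
    intro b hab hb hZ hsimple
    have hz := (hZ z).1 (Finset.mem_insert_self z Z)
    have hg' := hsimple z (Finset.mem_insert_self z Z)
    have hev := eventually_mul_pos_of_hasDerivAt (hg z).hasDerivAt hz.2 hg'
    have hlt : ∀ᶠ x in 𝓝[<] z, ∀ y ∈ Z, y < x := by
      rw [Finset.eventually_all]
      exact fun y hy => Filter.Eventually.filter_mono nhdsWithin_le_nhds (lt_mem_nhds (hmax y hy))
    have hleft := ((hev.filter_mono (nhdsLT_le_nhdsNE z)).and hlt).and
      ((Filter.Eventually.filter_mono nhdsWithin_le_nhds (lt_mem_nhds hz.1.1)).and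
        (self_mem_nhdsWithin : ∀ᶠ x in 𝓝[<] z, x ∈ Iio z))
    obtain ⟨b', ⟨hb'₁, hb'Z⟩, hab', hb'z⟩ := hleft.exists
    have hright := (hev.filter_mono (nhdsGT_le_nhdsNE z)).and
      ((Filter.Eventually.filter_mono nhdsWithin_le_nhds (gt_mem_nhds hz.1.2)).and
        (self_mem_nhdsWithin : ∀ᶠ x in 𝓝[>] z, x ∈ Ioi z))
    obtain ⟨c, hc₁, hcb, hzc⟩ := hright.exists
    have hmem : ∀ x, z < x → x < b → g x ≠ 0 := by
      intro x hzx hxb hx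
      rcases Finset.mem_insert.1 ((hZ x).2 ⟨⟨hz.1.1.trans hzx, hxb⟩, hx⟩) with h | h
      · exact hzx.ne' h
      · exact (hmax x h).not_gt hzx
    have hcb' : 0 < g c * g b := by
      refine mul_pos_of_forall_ne_zero hg.continuous hcb.le fun x hx => ?_
      rcases eq_or_lt_of_le hx.2 with rfl | h
      · exact hb
      · exact hmem x (hzc.trans_le hx.1) h
    have hsign : g b' * g c < 0 := by
      have h₁ : deriv g z * g b' < 0 := by
        have : 0 < (deriv g z * g b') * (b' - z) := by linarith [mul_assoc (deriv g z) (g b') (b' - z)]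
        exact neg_of_mul_pos_left this (sub_neg.2 hb'z).le
      have h₂ : 0 < deriv g z * g c := by
        have : 0 < (deriv g z * g c) * (c - z) := by linarith [mul_assoc (deriv g z) (g c) (c - z)]
        exact pos_of_mul_pos_left this (sub_pos.2 hzc).le
      have h₃ := mul_neg_of_neg_of_pos h₁ h₂
      have h₄ : (deriv g z * deriv g z) * (g b' * g c) < 0 := by linarith [h₃, mul_mul_mul_comm (deriv g z) (g b') (deriv g z) (g c)]
      exact neg_of_mul_neg_right h₄ (mul_self_nonneg _)
    have hb'₀ : g b' ≠ 0 := left_ne_zero_of_mul hsign.ne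
    have hih := ih b' hab' hb'₀ (fun x => ⟨fun hx => ?_, fun hx => ?_⟩) fun x hx =>
      hsimple x (Finset.mem_insert_of_mem hx)
    · rw [Finset.card_insert_of_notMem fun h => (hmax z h).false, Nat.even_add_one, hih]
      have hprod : (g a * g b') * (g a * g b) < 0 := by
        have h₁ : g b' * g b < 0 := by
          have : (g b' * g c) * (g c * g b) < 0 := mul_neg_of_neg_of_pos hsign hcb'
          have h₂ : (g c * g c) * (g b' * g b) < 0 := by linarith [mul_mul_mul_comm (g c) (g b') (g c) (g b), mul_comm (g b') (g c)]
          exact neg_of_mul_neg_right h₂ (mul_self_nonneg _)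
        have := mul_neg_of_pos_of_neg (mul_self_pos.2 ha) h₁
        linarith [mul_mul_mul_comm (g a) (g b') (g a) (g b)]
      constructor
      · intro h
        exact pos_of_mul_neg_right hprod (not_lt.1 h)
      · intro h h'
        exact (mul_pos h' h).not_gt hprod
    · have := (hZ x).1 (Finset.mem_insert_of_mem hx)
      exact ⟨⟨this.1.1, hb'Z x hx⟩, this.2⟩
    · rcases Finset.mem_insert.1 ((hZ x).2 ⟨⟨hx.1.1, hx.1.2.trans (hb'z.trans hz.1.2)⟩, hx.2⟩) with h | h
      · exact absurd (h ▸ hx.1.2) hb'z.not_gt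
      · exact h

theorem finite_even_zeros_Ioo {g : ℝ → ℝ} (hg : Differentiable ℝ g) {a b : ℝ} (hab : a < b)
    (hsign : 0 < g a * g b) (h : ∀ x ∈ Ioo a b, g x = 0 → deriv g x ≠ 0) :
    {x ∈ Ioo a b | g x = 0}.Finite ∧ Even {x ∈ Ioo a b | g x = 0}.ncard := by
  have ha : g a ≠ 0 := left_ne_zero_of_mul hsign.ne'
  have hb : g b ≠ 0 := right_ne_zero_of_mul hsign.ne'
  have hfin : {x ∈ Ioo a b | g x = 0}.Finite := by
    refine (finite_zeros_of_deriv_ne_zero hg (a := a) (b := b) fun x hx hx₀ => h x ?_ hx₀).subset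
      fun x hx => ⟨Ioo_subset_Icc_self hx.1, hx.2⟩
    exact ⟨lt_of_le_of_ne hx.1 fun h => ha (h ▸ hx₀), lt_of_le_of_ne hx.2 fun h => hb (h ▸ hx₀)⟩
  refine ⟨hfin, ?_⟩
  rw [ncard_eq_toFinset_card _ hfin,
    even_card_zeros_iff hg ha hfin.toFinset b hab hb (by simp) fun x hx => ?_]
  · exact hsign
  · rw [Finite.mem_toFinset] at hx
    exact h x hx.1 hx.2

/-- A window `(a, a + 1)` with `g a ≠ 0` has equal signs at its ends, and `Int.fract` maps its zeros
bijectively onto those in `[0, 1)`. -/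
theorem finite_even_zeros_of_periodic {g : ℝ → ℝ} (hg : Differentiable ℝ g)
    (hp : Function.Periodic g 1) (h : ∀ x, g x = 0 → deriv g x ≠ 0) :
    {x ∈ Ico (0 : ℝ) 1 | g x = 0}.Finite ∧ Even {x ∈ Ico (0 : ℝ) 1 | g x = 0}.ncard := by
  obtain ⟨a, ha⟩ : ∃ a, g a ≠ 0 := by
    by_contra! h₀
    refine h 0 (h₀ 0) ?_
    rw [show g = fun _ => 0 from funext h₀, deriv_const]
  have key := finite_even_zeros_Ioo hg (lt_add_one a) (by rw [hp a]; exact mul_self_pos.2 ha)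
    fun x _ => h x
  have hfract : ∀ x (n : ℤ), g (x + n) = g x := fun x n => by simpa using hp.int_mul n x
  have himage : {x ∈ Ico (0 : ℝ) 1 | g x = 0} = Int.fract '' {x ∈ Ioo a (a + 1) | g x = 0} := by
    ext x
    constructor
    · rintro ⟨hx, hx₀⟩
      have hy₀ : g (x + ⌈a - x⌉) = 0 := by rw [hfract, hx₀]
      refine ⟨x + ⌈a - x⌉, ⟨⟨lt_of_le_of_ne ?_ fun h => ha (h ▸ hy₀), ?_⟩, hy₀⟩, ?_⟩
      · linarith [Int.le_ceil (a - x)]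
      · linarith [Int.ceil_lt_add_one (a - x)]
      · rw [Int.fract_add_intCast, Int.fract_eq_self.2 hx]
    · rintro ⟨y, ⟨_, hy₀⟩, rfl⟩
      refine ⟨⟨Int.fract_nonneg y, Int.fract_lt_one y⟩, ?_⟩
      rw [← hfract _ ⌊y⌋, Int.fract_add_floor, hy₀]
  have hinj : InjOn Int.fract {x ∈ Ioo a (a + 1) | g x = 0} := by
    rintro x ⟨hx, _⟩ y ⟨hy, _⟩ hxy
    obtain ⟨n, hn⟩ := Int.fract_eq_fract.1 hxy
    have h₁ : (n : ℝ) < 1 := by linarith [hx.2, hy.1]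
    have h₂ : (-1 : ℝ) < n := by linarith [hx.1, hy.2]
    have : n = 0 := by
      have h₁' : n < 1 := by exact_mod_cast h₁
      have h₂' : -1 < n := by exact_mod_cast h₂
      omega
    rw [this, Int.cast_zero] at hn
    linarith
  rw [himage, hinj.ncard_image]
  exact ⟨key.1.image _, key.2⟩

theorem UniqueDiffWithinAt.deriv_eq_of_eqOn {E : Type*} [NormedAddCommGroup E] [NormedSpace ℝ E]
    {g h : ℝ → E} {S : Set ℝ} {x : ℝ} (hS : UniqueDiffWithinAt ℝ S x) (hx : x ∈ S) {g' h' : E}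
    (hg : HasDerivAt g g' x) (hh : HasDerivAt h h' x) (heq : EqOn g h S) : g' = h' :=
  hS.eq_deriv S hg.hasDerivWithinAt (hh.hasDerivWithinAt.congr heq (heq hx))

/-! ### Parallel pairs near the diagonal and the turning speed along a path -/

namespace RegularClosedCurve

variable (f : RegularClosedCurve)

theorem planeDet_eq_zero_of_mem_closure {p : ℝ × ℝ} (hp : p ∈ closure f.parallelPairs) :
    planeDet (f.d 1 p.1) (f.d 1 p.2) = 0 := by
  have hc : Continuous fun p : ℝ × ℝ => planeDet (f.d 1 p.1) (f.d 1 p.2) :=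
    continuous_planeDet.comp (((f.continuous_d 1).comp continuous_fst).prodMk
      ((f.continuous_d 1).comp continuous_snd))
  refine closure_minimal (fun q hq => ?_) (isClosed_singleton.preimage hc : IsClosed _) hp
  have := hq.2
  rwa [← d_one] at this

theorem swap_mem_closure_parallelPairs {p : ℝ × ℝ} (hp : p ∈ closure f.parallelPairs) :
    p.swap ∈ closure f.parallelPairs :=
  map_mem_closure continuous_swap hp fun q hq =>
    ⟨hq.1.symm, by rw [planeDet_swap]; simpa using hq.2⟩

/-- Near a point of a curve with nondegenerate inflexion points, two parallel tangents touch the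
curve on different sides of this point. -/
theorem exists_forall_parallel_lt (hf : f.HasSimpleInflexions) (x : ℝ) :
    ∃ ε > 0, ∀ a ∈ Ioo (x - ε) (x + ε), ∀ b ∈ Ioo (x - ε) (x + ε), a < b →
      planeDet (f.d 1 a) (f.d 1 b) = 0 → a < x ∧ x < b := by
  set v := f.d 1 x with hv
  let X : ℝ → ℝ := fun z => v 0 * f.d 1 z 0 + v 1 * f.d 1 z 1
  have hX : ∀ z, HasDerivAt X (v 0 * f.d 2 z 0 + v 1 * f.d 2 z 1) z := fun z =>
    (((f.hasDerivAt_d 1 z).plane_apply 0).const_mul _).add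
      (((f.hasDerivAt_d 1 z).plane_apply 1).const_mul _)
  have hX₀ : X x ≠ 0 := (planeSq_pos (f.d_one_ne_zero x)).ne'
  have h₁ := (hX x).continuousAt.eventually_ne hX₀
  have h₂ : ∀ᶠ z in 𝓝 x, f.curv z = 0 → z = x := by
    by_cases hx : f.curv x = 0
    · have := (f.hasDerivAt_curv x).eventually_ne (c := 0) (hf x hx)
      rw [eventually_nhdsWithin_iff] at this
      filter_upwards [this] with z hz hz₀
      by_contra hne
      exact hz hne hz₀
    · filter_upwards [f.continuous_curv.continuousAt.eventually_ne hx] with z hz hz₀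
      exact absurd hz₀ hz
  obtain ⟨ε, hε, hball⟩ := Metric.eventually_nhds_iff_ball.1 (h₁.and h₂)
  rw [Real.ball_eq_Ioo] at hball
  refine ⟨ε, hε, fun a ha b hb hab hdet => ?_⟩
  have hsub : ∀ z ∈ Icc a b, z ∈ Ioo (x - ε) (x + ε) := fun z hz =>
    ⟨ha.1.trans_le hz.1, hz.2.trans_lt hb.2⟩
  -- This is the slope of the tangent in the orthogonal frame of `v`. Parallel tangents have equal
  -- slopes, so Rolle gives a zero of the curvature strictly between `a` and `b`, and near `x` it
  -- can only be `x`.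
  let m : ℝ → ℝ := fun z => planeDet v (f.d 1 z) / X z
  have hm : ∀ z ∈ Icc a b, HasDerivAt m (f.curv z * planeSq v / X z ^ 2) z := by
    intro z hz
    have h := ((hasDerivAt_const z v).planeDet (f.hasDerivAt_d 1 z)).div (hX z) (hball z (hsub z hz)).1
    refine h.congr_deriv ?_
    congr 1
    simp only [X, curv, planeDet, planeSq, PiLp.zero_apply]
    ring
  have hmab : m a = m b := by
    obtain ⟨t, ht⟩ := exists_smul_of_planeDet_eq_zero (f.d_one_ne_zero a) hdet
    have hXa := (hball a ha).1
    have hXb := (hball b hb).1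
    simp only [m]
    rw [div_eq_div_iff hXa hXb]
    simp only [X, ht, planeDet, PiLp.smul_apply, smul_eq_mul]
    ring
  obtain ⟨c, hc, hc₀⟩ := exists_hasDerivAt_eq_zero hab
    (fun z hz => (hm z hz).continuousAt.continuousWithinAt) hmab
    fun z hz => hm z (Ioo_subset_Icc_self hz)
  have hcI := Ioo_subset_Icc_self hc
  have hcurv : f.curv c = 0 := by
    have h₁ := (hball c (hsub c hcI)).1
    have h₂ : planeSq v ≠ 0 := (planeSq_pos (f.d_one_ne_zero x)).ne'
    simpa [h₁, h₂] using hc₀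
  have := (hball c (hsub c hcI)).2 hcurv
  exact this ▸ hc

theorem mul_nonpos_of_mem_closure {x ε : ℝ} (n : ℤ)
    (h : ∀ a ∈ Ioo (x - ε) (x + ε), ∀ b ∈ Ioo (x - ε) (x + ε), a < b →
      planeDet (f.d 1 a) (f.d 1 b) = 0 → a < x ∧ x < b) {p : ℝ × ℝ}
    (hp : p ∈ closure f.parallelPairs) (h₁ : p.1 ∈ Ioo (x - ε) (x + ε))
    (h₂ : p.2 - n ∈ Ioo (x - ε) (x + ε)) : (p.1 - x) * (p.2 - n - x) ≤ 0 := by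
  let U : Set (ℝ × ℝ) := {q | q.1 ∈ Ioo (x - ε) (x + ε) ∧ q.2 - n ∈ Ioo (x - ε) (x + ε)}
  have hU : IsOpen U :=
    (isOpen_Ioo.preimage continuous_fst).inter
      (isOpen_Ioo.preimage (continuous_snd.sub continuous_const))
  have hc : Continuous fun q : ℝ × ℝ => (q.1 - x) * (q.2 - n - x) := by fun_prop
  refine closure_minimal (s := f.parallelPairs ∩ U) (fun q hq => ?_)
    (isClosed_Iic.preimage hc : IsClosed {q : ℝ × ℝ | (q.1 - x) * (q.2 - n - x) ∈ Iic 0})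
    (hU.closure_inter ⟨hp, h₁, h₂⟩)
  obtain ⟨⟨hne, hdet⟩, hq₁, hq₂⟩ := hq
  have hdet' : planeDet (f.d 1 q.1) (f.d 1 (q.2 - n)) = 0 := by
    rw [← f.d_add_int 1 (q.2 - n) n, sub_add_cancel, d_one]
    exact hdet
  rcases lt_trichotomy q.1 (q.2 - n) with hlt | heq | hlt
  · obtain ⟨h₃, h₄⟩ := h _ hq₁ _ hq₂ hlt hdet'
    exact mul_nonpos_of_nonpos_of_nonneg (sub_neg.2 h₃).le (sub_pos.2 h₄).le
  · refine absurd ?_ hne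
    have := f.d_add_int 0 (q.2 - n) n
    simp only [d, iteratedDeriv_zero, sub_add_cancel] at this
    rw [this, heq]
  · rw [planeDet_swap, neg_eq_zero] at hdet'
    obtain ⟨h₃, h₄⟩ := h _ hq₂ _ hq₁ hlt hdet'
    exact mul_nonpos_of_nonneg_of_nonpos (sub_pos.2 h₄).le (sub_neg.2 h₃).le

/-- The angular speed of the tangent line of the curve. -/
noncomputable def angularSpeed (x : ℝ) : ℝ := f.curv x / planeSq (f.d 1 x)

theorem angularSpeed_add_int (x : ℝ) (n : ℤ) : f.angularSpeed (x + n) = f.angularSpeed x := by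
  simp [angularSpeed, curv_add_int, d_add_int]

theorem differentiable_angularSpeed : Differentiable ℝ f.angularSpeed := fun x =>
  ((f.hasDerivAt_curv x).div (f.hasDerivAt_d 1 x).planeSq
    (planeSq_pos (f.d_one_ne_zero x)).ne').differentiableAt

theorem angularSpeed_eq_zero_iff {x : ℝ} : f.angularSpeed x = 0 ↔ f.curv x = 0 := by
  simp [angularSpeed, (planeSq_pos (f.d_one_ne_zero x)).ne']

theorem curv_eq_angularSpeed_mul (x : ℝ) : f.curv x = f.angularSpeed x * planeSq (f.d 1 x) :=
  (div_mul_cancel₀ _ (planeSq_pos (f.d_one_ne_zero x)).ne').symm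

variable {f} in
theorem HasSimpleInflexions.deriv_angularSpeed_ne_zero (hf : f.HasSimpleInflexions) {x : ℝ}
    (hx : f.angularSpeed x = 0) : deriv f.angularSpeed x ≠ 0 := by
  rw [angularSpeed_eq_zero_iff] at hx
  have hp := (planeSq_pos (f.d_one_ne_zero x)).ne'
  have h : HasDerivAt f.angularSpeed _ x :=
    (f.hasDerivAt_curv x).div (f.hasDerivAt_d 1 x).planeSq hp
  rw [h.deriv, hx]
  simpa [hp] using hf x hx

/-- A smooth regular path `τ ↦ (s τ, t τ)` of (limits of) parallel pairs, for `τ ∈ S`. -/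
structure ParallelPath (S : Set ℝ) (s t : ℝ → ℝ) : Prop where
  contDiff_fst : ContDiff ℝ ∞ s
  contDiff_snd : ContDiff ℝ ∞ t
  uniqueDiffOn : UniqueDiffOn ℝ S
  regular : ∀ τ ∈ S, deriv s τ = 0 → deriv t τ ≠ 0
  mem : ∀ τ ∈ S, (s τ, t τ) ∈ closure f.parallelPairs

namespace ParallelPath

variable {f} {S : Set ℝ} {s t : ℝ → ℝ}

theorem symm (h : f.ParallelPath S s t) : f.ParallelPath S t s where
  contDiff_fst := h.contDiff_snd
  contDiff_snd := h.contDiff_fst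
  uniqueDiffOn := h.uniqueDiffOn
  regular τ hτ h₁ h₂ := h.regular τ hτ h₂ h₁
  mem τ hτ := f.swap_mem_closure_parallelPairs (h.mem τ hτ)

theorem hasDerivAt_fst (h : f.ParallelPath S s t) (τ : ℝ) : HasDerivAt s (deriv s τ) τ :=
  (h.contDiff_fst.differentiable (by simp) τ).hasDerivAt

theorem hasDerivAt_deriv_fst (h : f.ParallelPath S s t) (τ : ℝ) :
    HasDerivAt (deriv s) (deriv (deriv s) τ) τ :=
  ((contDiff_infty_iff_deriv.1 h.contDiff_fst).2.differentiable (by simp) τ).hasDerivAt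

theorem planeDet_eq_zero (h : f.ParallelPath S s t) {τ : ℝ} (hτ : τ ∈ S) :
    planeDet (f.d 1 (s τ)) (f.d 1 (t τ)) = 0 :=
  f.planeDet_eq_zero_of_mem_closure (p := (s τ, t τ)) (h.mem τ hτ)

theorem exists_smul (h : f.ParallelPath S s t) {τ : ℝ} (hτ : τ ∈ S) :
    ∃ c : ℝ, c ≠ 0 ∧ f.d 1 (t τ) = c • f.d 1 (s τ) := by
  obtain ⟨c, hc⟩ := exists_smul_of_planeDet_eq_zero (f.d_one_ne_zero _) (h.planeDet_eq_zero hτ)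
  refine ⟨c, ?_, hc⟩
  rintro rfl
  exact f.d_one_ne_zero (t τ) (by rw [hc, zero_smul])

theorem hasDerivAt_comp_fst (h : f.ParallelPath S s t) (k : ℕ) (τ : ℝ) :
    HasDerivAt (fun τ => f.d k (s τ)) (deriv s τ • f.d (k + 1) (s τ)) τ :=
  (f.hasDerivAt_d k (s τ)).scomp τ (h.hasDerivAt_fst τ)

/-- Both tangent lines of a parallel pair turn with the same angular speed. -/
theorem angularSpeed_mul_deriv_eq (h : f.ParallelPath S s t) {τ : ℝ} (hτ : τ ∈ S) :
    f.angularSpeed (s τ) * deriv s τ = f.angularSpeed (t τ) * deriv t τ := by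
  have h₁ := (h.uniqueDiffOn τ hτ).deriv_eq_of_eqOn hτ
    ((h.hasDerivAt_comp_fst 1 τ).planeDet (h.symm.hasDerivAt_comp_fst 1 τ))
    (hasDerivAt_const τ (0 : ℝ)) fun σ hσ => h.planeDet_eq_zero hσ
  obtain ⟨c, hc, hcs⟩ := h.exists_smul hτ
  have hp := (planeSq_pos (f.d_one_ne_zero (s τ))).ne'
  rw [planeDet_smul_left, planeDet_smul_right, hcs, planeDet_smul_right, planeDet_swap] at h₁
  rw [angularSpeed, angularSpeed, curv, curv, hcs, planeDet_smul_left, planeSq_smul]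
  simp only [Nat.reduceAdd] at h₁
  field_simp
  linear_combination -h₁

theorem differentiable_turning (h : f.ParallelPath S s t) :
    Differentiable ℝ fun τ => f.angularSpeed (s τ) * deriv s τ := fun τ =>
  (((f.differentiable_angularSpeed (s τ)).comp τ (h.hasDerivAt_fst τ).differentiableAt)).mul
    (h.hasDerivAt_deriv_fst τ).differentiableAt

theorem hasDerivAt_turning (h : f.ParallelPath S s t) (τ : ℝ) :
    HasDerivAt (fun τ => f.angularSpeed (s τ) * deriv s τ)
      (deriv f.angularSpeed (s τ) * deriv s τ ^ 2 + f.angularSpeed (s τ) * deriv (deriv s) τ) τ := by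
  refine (((f.differentiable_angularSpeed (s τ)).hasDerivAt.comp τ (h.hasDerivAt_fst τ)).mul
    (h.hasDerivAt_deriv_fst τ)).congr_deriv ?_
  simp only [Function.comp_apply]
  ring

theorem deriv_turning_eq (h : f.ParallelPath S s t) {τ : ℝ} (hτ : τ ∈ S) :
    deriv f.angularSpeed (s τ) * deriv s τ ^ 2 + f.angularSpeed (s τ) * deriv (deriv s) τ =
      deriv f.angularSpeed (t τ) * deriv t τ ^ 2 + f.angularSpeed (t τ) * deriv (deriv t) τ :=
  (h.uniqueDiffOn τ hτ).deriv_eq_of_eqOn hτ (h.hasDerivAt_turning τ) (h.symm.hasDerivAt_turning τ)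
    fun _ hσ => h.angularSpeed_mul_deriv_eq hσ

/-- If `s' ≠ 0`, then `κ(s) = 0` and the derivative reduces to `κ'(s) s'² ≠ 0`. If `s' = 0`, then
`t' ≠ 0` by regularity, and the same holds for the equal expression in `t`. -/
theorem deriv_turning_ne_zero (h : f.ParallelPath S s t) (hf : f.HasSimpleInflexions) {τ : ℝ}
    (hτ : τ ∈ S) (h₀ : f.angularSpeed (s τ) * deriv s τ = 0) :
    deriv (fun τ => f.angularSpeed (s τ) * deriv s τ) τ ≠ 0 := by
  rw [(h.hasDerivAt_turning τ).deriv]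
  by_cases hs : deriv s τ = 0
  · have ht := h.regular τ hτ hs
    rw [h.angularSpeed_mul_deriv_eq hτ] at h₀
    have h₁ := (mul_eq_zero.1 h₀).resolve_right ht
    rw [h.deriv_turning_eq hτ, h₁, zero_mul, add_zero]
    exact mul_ne_zero (hf.deriv_angularSpeed_ne_zero h₁) (pow_ne_zero 2 ht)
  · have h₁ := (mul_eq_zero.1 h₀).resolve_right hs
    rw [h₁, zero_mul, add_zero]
    exact mul_ne_zero (hf.deriv_angularSpeed_ne_zero h₁) (pow_ne_zero 2 hs)

theorem hasDerivAt_pointMap (h : f.ParallelPath S s t) (lam τ : ℝ) :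
    HasDerivAt (fun σ => f.pointMap lam (s σ, t σ))
      (lam • deriv s τ • f.d 1 (s τ) + (1 - lam) • deriv t τ • f.d 1 (t τ)) τ := by
  have h₁ := h.hasDerivAt_comp_fst 0 τ
  have h₂ := h.symm.hasDerivAt_comp_fst 0 τ
  simp only [d, iteratedDeriv_zero] at h₁ h₂
  exact (h₁.const_smul lam).add (h₂.const_smul (1 - lam))

theorem hasDerivAt_deriv_pointMap (h : f.ParallelPath S s t) (lam τ : ℝ) :
    HasDerivAt (deriv fun σ => f.pointMap lam (s σ, t σ))
      (lam • (deriv s τ • deriv s τ • f.d 2 (s τ) + deriv (deriv s) τ • f.d 1 (s τ)) +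
        (1 - lam) • (deriv t τ • deriv t τ • f.d 2 (t τ) + deriv (deriv t) τ • f.d 1 (t τ))) τ := by
  rw [funext fun τ => (h.hasDerivAt_pointMap lam τ).deriv]
  exact (((h.hasDerivAt_deriv_fst τ).smul (h.hasDerivAt_comp_fst 1 τ)).const_smul lam).add
    (((h.symm.hasDerivAt_deriv_fst τ).smul (h.symm.hasDerivAt_comp_fst 1 τ)).const_smul (1 - lam))

/-- The branch has an inflexion point exactly where it is regular and its tangent line stops
turning. -/
theorem isInflexion_iff (h : f.ParallelPath S s t) (lam : ℝ) {τ c : ℝ} (hτ : τ ∈ S)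
    (hc : f.d 1 (t τ) = c • f.d 1 (s τ)) :
    IsInflexion (fun σ => f.pointMap lam (s σ, t σ)) τ ↔
      lam * deriv s τ + (1 - lam) * deriv t τ * c ≠ 0 ∧ f.angularSpeed (s τ) * deriv s τ = 0 := by
  set w := lam * deriv s τ + (1 - lam) * deriv t τ * c with hw
  have h₁ : deriv (fun σ => f.pointMap lam (s σ, t σ)) τ = w • f.d 1 (s τ) := by
    rw [(h.hasDerivAt_pointMap lam τ).deriv, hc]
    module
  have hp := (planeSq_pos (f.d_one_ne_zero (s τ))).ne'
  have h₂ : planeDet (deriv (fun σ => f.pointMap lam (s σ, t σ)) τ)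
      (deriv (deriv fun σ => f.pointMap lam (s σ, t σ)) τ) =
      w ^ 2 * planeSq (f.d 1 (s τ)) * (f.angularSpeed (s τ) * deriv s τ) := by
    have hk₁ := f.curv_eq_angularSpeed_mul (s τ)
    have hk₂ := f.curv_eq_angularSpeed_mul (t τ)
    have heq := h.angularSpeed_mul_deriv_eq hτ
    rw [h₁, (h.hasDerivAt_deriv_pointMap lam τ).deriv]
    rw [curv] at hk₁ hk₂
    rw [hc, planeDet_smul_left, planeSq_smul] at hk₂
    simp only [planeDet_smul_left, planeDet_smul_right, planeDet_add_right, hc, planeDet_self, hk₁]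
    have hk₃ : c = 0 ∨ planeDet (f.d 1 (s τ)) (f.d 2 (t τ)) =
        c * (f.angularSpeed (t τ) * planeSq (f.d 1 (s τ))) := by
      by_cases hc₀ : c = 0
      · exact Or.inl hc₀
      · right
        apply mul_left_cancel₀ hc₀
        linear_combination hk₂
    rcases hk₃ with rfl | hk₃
    · exact absurd (by rw [hc, zero_smul]) (f.d_one_ne_zero (t τ))
    · rw [hk₃, hw]
      linear_combination (-(w * (1 - lam) * deriv t τ * c * planeSq (f.d 1 (s τ)))) * heq
  rw [IsInflexion, h₂, h₁]
  constructor
  · rintro ⟨h₃, h₄⟩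
    have hw₀ : w ≠ 0 := left_ne_zero_of_smul h₃
    refine ⟨hw₀, ?_⟩
    simpa [hw₀, hp] using h₄
  · rintro ⟨h₃, h₄⟩
    exact ⟨smul_ne_zero h₃ (f.d_one_ne_zero _), by rw [h₄, mul_zero]⟩

end ParallelPath

end RegularClosedCurve

/-! ### Diagonal crossings and inflexions of branches -/

/-- The integers are closed, so `h - g` takes an integer value at `x`. With a nonzero derivative it
would avoid that integer nearby, and by continuity all others. -/
theorem exists_int_and_deriv_eq_of_frequently {g h : ℝ → ℝ} {g' h' x : ℝ} (hg : HasDerivAt g g' x)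
    (hh : HasDerivAt h h' x) (hfreq : ∃ᶠ y in 𝓝[≠] x, ∃ m : ℤ, h y = g y + m) :
    (∃ m : ℤ, h x = g x + m) ∧ h' = g' := by
  have hD : HasDerivAt (fun y => h y - g y) (h' - g') x := hh.sub hg
  have hfreq' : ∃ᶠ y in 𝓝[≠] x, h y - g y ∈ range ((↑) : ℤ → ℝ) :=
    hfreq.mono fun y ⟨m, hm⟩ => ⟨m, by rw [hm]; ring⟩
  obtain ⟨m, hm⟩ : h x - g x ∈ range ((↑) : ℤ → ℝ) := by
    by_contra hx
    have hopen := Int.isClosedEmbedding_coe_real.isClosed_range.isOpen_compl.mem_nhds hx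
    exact hfreq' ((hD.continuousAt.eventually hopen).filter_mono nhdsWithin_le_nhds)
  refine ⟨⟨m, by rw [hm]; ring⟩, ?_⟩
  by_contra hne
  have h₁ := hD.eventually_ne (c := (m : ℝ)) (sub_ne_zero.2 hne)
  have h₂ : ∀ᶠ y in 𝓝[≠] x, h y - g y ∈ Metric.ball (m : ℝ) 1 :=
    (hD.continuousAt.eventually (hm ▸ Metric.ball_mem_nhds _ one_pos)).filter_mono
      nhdsWithin_le_nhds
  refine hfreq' ?_
  filter_upwards [h₁, h₂] with y hy₁ hy₂
  rintro ⟨k, hk⟩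
  rw [← hk, Metric.mem_ball, Int.dist_cast_real, Int.dist_eq'] at hy₂
  rw [← hk] at hy₁
  refine hy₁ ?_
  have h₃ : |k - m| < 1 := by exact_mod_cast hy₂
  rw [Int.abs_lt_one_iff, sub_eq_zero] at h₃
  rw [h₃]

namespace RegularClosedCurve

variable {f : RegularClosedCurve}

namespace ParallelPath

variable {S : Set ℝ} {s t : ℝ → ℝ}

/-- Nearby parallel pairs lie on opposite sides of the diagonal point, so the difference quotients
of `s` and `t` have nonpositive product; this passes to the limit, also at an end of the interval.
-/
theorem mul_deriv_nonpos_of_diag (h : f.ParallelPath S s t) (hf : f.HasSimpleInflexions) {τ : ℝ}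
    (hτ : τ ∈ S) {n : ℤ} (hn : t τ = s τ + n) : deriv s τ * deriv t τ ≤ 0 := by
  obtain ⟨ε, hε, hloc⟩ := f.exists_forall_parallel_lt hf (s τ)
  have hacc := uniqueDiffWithinAt_iff_accPt.1 (h.uniqueDiffOn τ hτ)
  rw [accPt_principal_iff_nhdsWithin] at hacc
  have hle : 𝓝[S \ {τ}] τ ≤ 𝓝[≠] τ := nhdsWithin_mono τ fun x hx => hx.2
  have hs := (hasDerivAt_iff_tendsto_slope.1 (h.hasDerivAt_fst τ)).mono_left hle
  have ht := (hasDerivAt_iff_tendsto_slope.1 (h.symm.hasDerivAt_fst τ)).mono_left hle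
  refine le_of_tendsto (hs.mul ht) ?_
  have hI : ∀ᶠ σ in 𝓝 τ, s σ ∈ Ioo (s τ - ε) (s τ + ε) :=
    (h.hasDerivAt_fst τ).continuousAt.eventually (Ioo_mem_nhds (by linarith) (by linarith))
  have hJ : ∀ᶠ σ in 𝓝 τ, t σ ∈ Ioo (t τ - ε) (t τ + ε) :=
    (h.symm.hasDerivAt_fst τ).continuousAt.eventually (Ioo_mem_nhds (by linarith) (by linarith))
  filter_upwards [(hI.and hJ).filter_mono nhdsWithin_le_nhds, self_mem_nhdsWithin] with σ hσ hσS
  have hprod := f.mul_nonpos_of_mem_closure n hloc (p := (s σ, t σ)) (h.mem σ hσS.1) hσ.1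
    ⟨by linarith [hσ.2.1], by linarith [hσ.2.2]⟩
  have heq : slope s τ σ * slope t τ σ = (s σ - s τ) * (t σ - n - s τ) / ((σ - τ) * (σ - τ)) := by
    rw [slope_def_field, slope_def_field, div_mul_div_comm, hn]
    ring
  rw [heq]
  exact div_nonpos_of_nonpos_of_nonneg hprod (mul_self_nonneg _)

/-- A path of parallel pairs crosses the diagonal perpendicularly. -/
theorem deriv_eq_neg_of_diag (h : f.ParallelPath S s t) (hf : f.HasSimpleInflexions) {τ : ℝ}
    (hτ : τ ∈ S) {n : ℤ} (hn : t τ = s τ + n) : deriv t τ = -deriv s τ ∧ deriv s τ ≠ 0 := by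
  have hle := h.mul_deriv_nonpos_of_diag hf hτ hn
  have hreg := h.regular τ hτ
  have h₁ := h.angularSpeed_mul_deriv_eq hτ
  rw [hn, f.angularSpeed_add_int] at h₁
  -- Where `κ ≠ 0`, the turning identity gives `s' = t'`. Where `κ = 0` it is void, and its
  -- derivative gives `κ' s'² = κ' t'²`. The sign of `s' t'` then selects `t' = -s'`.
  have hsq : deriv s τ ^ 2 = deriv t τ ^ 2 := by
    by_cases hk : f.angularSpeed (s τ) = 0
    · have h₂ := h.deriv_turning_eq hτ
      have hk' : f.angularSpeed (t τ) = 0 := by rw [hn, f.angularSpeed_add_int, hk]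
      have hd : deriv f.angularSpeed (t τ) = deriv f.angularSpeed (s τ) := by
        have := deriv_comp_add_const f.angularSpeed (n : ℝ) (s τ)
        rw [hn, ← this]
        congr 1
        exact funext fun x => f.angularSpeed_add_int x n
      rw [hk, hk', hd, zero_mul, zero_mul, add_zero, add_zero] at h₂
      exact mul_left_cancel₀ (hf.deriv_angularSpeed_ne_zero hk) h₂
    · rw [mul_left_cancel₀ hk h₁]
  have hs : deriv s τ ≠ 0 := by
    intro hs
    rw [hs, zero_pow two_ne_zero, eq_comm, sq_eq_zero_iff] at hsq
    exact hreg hs hsq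
  refine ⟨?_, hs⟩
  rcases sq_eq_sq_iff_eq_or_eq_neg.1 hsq with h₂ | h₂
  · rw [← h₂] at hle
    exact absurd hle (mul_self_pos.2 hs).not_ge
  · rw [h₂, neg_neg]

/-- Here `s` increases and `t` decreases through the diagonal, so some `τ₂` after `τ` has `s(τ₂)`
equal to an earlier `t(τ₁)` modulo `ℤ`. The partners `s(τ₁)` and `t(τ₂) - n` then have parallel
tangents and lie on the same side of `s(τ)`, which forces them to coincide. -/
theorem exists_samePair_of_diag_of_pos (h : f.ParallelPath S s t) (hf : f.HasSimpleInflexions)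
    {τ : ℝ} (hS : S ∈ 𝓝 τ) {n : ℤ} (hn : t τ = s τ + n) (hpos : 0 < deriv s τ) {δ : ℝ}
    (hδ : 0 < δ) : ∃ τ₁ ∈ Ioo (τ - δ) τ, ∃ τ₂ ∈ Ioo τ (τ + δ), ∃ m k : ℤ,
      s τ₂ = t τ₁ + m ∧ t τ₂ = s τ₁ + k := by
  obtain ⟨ε, hε, hloc⟩ := f.exists_forall_parallel_lt hf (s τ)
  have hneg : deriv t τ < 0 := by
    rw [(h.deriv_eq_neg_of_diag hf (mem_of_mem_nhds hS) hn).1]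
    exact neg_lt_zero.2 hpos
  have hcs : Continuous s := h.contDiff_fst.continuous
  have hct : Continuous t := h.contDiff_snd.continuous
  have hI : ∀ᶠ σ in 𝓝 τ, s σ ∈ Ioo (s τ - ε) (s τ + ε) :=
    hcs.continuousAt.eventually (Ioo_mem_nhds (by linarith) (by linarith))
  have hJ : ∀ᶠ σ in 𝓝 τ, t σ ∈ Ioo (t τ - ε) (t τ + ε) :=
    hct.continuousAt.eventually (Ioo_mem_nhds (by linarith) (by linarith))
  have hA := eventually_mul_pos_of_hasDerivAt ((h.hasDerivAt_fst τ).sub_const (s τ)) (sub_self _)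
    hpos.ne'
  have hB := eventually_mul_pos_of_hasDerivAt ((h.symm.hasDerivAt_fst τ).sub_const (t τ))
    (sub_self _) hneg.ne
  rw [eventually_nhdsWithin_iff] at hA hB
  have hS' : ∀ᶠ σ in 𝓝 τ, σ ∈ S := hS
  obtain ⟨r₀, hr₀, hball⟩ := Metric.eventually_nhds_iff_ball.1
    ((hI.and hJ).and ((hA.and hB).and hS'))
  rw [Real.ball_eq_Ioo] at hball
  set r := min r₀ δ / 2 with hr
  have hr₁ : 0 < r := half_pos (lt_min hr₀ hδ)
  have hr₂ : r < r₀ := by linarith [min_le_left r₀ δ]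
  have hr₃ : r < δ := by linarith [min_le_right r₀ δ]
  have hs_pos : ∀ σ ∈ Ioo (τ - r₀) (τ + r₀), τ < σ → s τ < s σ := fun σ hσ hlt => by
    have h₁ := pos_of_mul_pos_right ((hball σ hσ).2.1.1 hlt.ne') hpos.le
    linarith [pos_of_mul_pos_left h₁ (sub_pos.2 hlt).le]
  have hs_neg : ∀ σ ∈ Ioo (τ - r₀) (τ + r₀), σ < τ → s σ < s τ := fun σ hσ hlt => by
    have h₁ := pos_of_mul_pos_right ((hball σ hσ).2.1.1 hlt.ne) hpos.le
    linarith [neg_of_mul_pos_left h₁ (sub_neg.2 hlt).le]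
  have ht_neg : ∀ σ ∈ Ioo (τ - r₀) (τ + r₀), τ < σ → t σ < t τ := fun σ hσ hlt => by
    have h₁ := neg_of_mul_pos_right ((hball σ hσ).2.1.2 hlt.ne') hneg.le
    linarith [neg_of_mul_neg_left h₁ (sub_pos.2 hlt).le]
  have ht_pos : ∀ σ ∈ Ioo (τ - r₀) (τ + r₀), σ < τ → t τ < t σ := fun σ hσ hlt => by
    have h₁ := neg_of_mul_pos_right ((hball σ hσ).2.1.2 hlt.ne) hneg.le
    linarith [pos_of_mul_neg_left h₁ (sub_neg.2 hlt).le]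
  have hbmem : τ + r ∈ Ioo (τ - r₀) (τ + r₀) := ⟨by linarith, by linarith⟩
  have hb := hs_pos _ hbmem (by linarith)
  have hsmall : ∀ᶠ σ in 𝓝[<] τ, t σ < s (τ + r) + n :=
    (hct.continuousAt.eventually (gt_mem_nhds (by rw [hn]; linarith))).filter_mono
      nhdsWithin_le_nhds
  obtain ⟨τ₁, hτ₁, hτ₁'⟩ := (hsmall.and (Ioo_mem_nhdsLT (show τ - r < τ by linarith))).exists
  have hm₁ : τ₁ ∈ Ioo (τ - r₀) (τ + r₀) := ⟨by linarith [hτ₁'.1], by linarith [hτ₁'.2]⟩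
  have ht₁ := ht_pos τ₁ hm₁ hτ₁'.2
  have hs₁ := hs_neg τ₁ hm₁ hτ₁'.2
  obtain ⟨τ₂, hτ₂, hst⟩ := intermediate_value_Icc (show τ ≤ τ + r by linarith) hcs.continuousOn
    (show t τ₁ - n ∈ Icc (s τ) (s (τ + r)) from ⟨by linarith, by linarith⟩)
  have hlt₂ : τ < τ₂ := lt_of_le_of_ne hτ₂.1 fun heq => by
    rw [← heq] at hst
    linarith
  have hm₂ : τ₂ ∈ Ioo (τ - r₀) (τ + r₀) := ⟨by linarith, by linarith [hτ₂.2]⟩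
  have ht₂ := ht_neg τ₂ hm₂ hlt₂
  refine ⟨τ₁, ⟨by linarith [hτ₁'.1], hτ₁'.2⟩, τ₂, ⟨hlt₂, by linarith [hτ₂.2]⟩, -n, n,
    by rw [hst]; push_cast; ring, ?_⟩
  have hd : f.d 1 (s τ₂) = f.d 1 (t τ₁) := by
    rw [hst, ← f.d_add_int 1 _ n, sub_add_cancel]
  have hdt : f.d 1 (t τ₂ - n) = f.d 1 (t τ₂) := by
    rw [← f.d_add_int 1 _ n, sub_add_cancel]
  have hpar : planeDet (f.d 1 (s τ₁)) (f.d 1 (t τ₂ - n)) = 0 := by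
    refine planeDet_eq_zero_trans (f.d_one_ne_zero (t τ₁))
      (h.planeDet_eq_zero (hball τ₁ hm₁).2.2) ?_
    rw [← hd, hdt]
    exact h.planeDet_eq_zero (hball τ₂ hm₂).2.2
  have hI₁ := (hball τ₁ hm₁).1.1
  have hJ₂ : t τ₂ - n ∈ Ioo (s τ - ε) (s τ + ε) :=
    ⟨by linarith [(hball τ₂ hm₂).1.2.1], by linarith [(hball τ₂ hm₂).1.2.2]⟩
  rcases lt_trichotomy (s τ₁) (t τ₂ - n) with hlt | heq | hlt
  · linarith [(hloc _ hI₁ _ hJ₂ hlt hpar).2]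
  · linarith
  · rw [planeDet_swap, neg_eq_zero] at hpar
    linarith [(hloc _ hJ₂ _ hI₁ hlt hpar).2]

/-- Where a path of parallel pairs crosses the diagonal it is folded: unordered pairs are attained
twice. -/
theorem exists_samePair_of_diag (h : f.ParallelPath S s t) (hf : f.HasSimpleInflexions)
    {τ : ℝ} (hS : S ∈ 𝓝 τ) {n : ℤ} (hn : t τ = s τ + n) {δ : ℝ} (hδ : 0 < δ) :
    ∃ τ₁ ∈ Ioo (τ - δ) τ, ∃ τ₂ ∈ Ioo τ (τ + δ), SamePair (1 / 2) (s τ₁, t τ₁) (s τ₂, t τ₂) := by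
  obtain ⟨ht, hs⟩ := h.deriv_eq_neg_of_diag hf (mem_of_mem_nhds hS) hn
  rcases lt_or_gt_of_ne hs with hneg | hpos
  · obtain ⟨τ₁, h₁, τ₂, h₂, m, k, hm, hk⟩ := h.symm.exists_samePair_of_diag_of_pos hf hS (n := -n)
      (by rw [hn]; push_cast; ring) (by rw [ht]; linarith) hδ
    exact ⟨τ₁, h₁, τ₂, h₂, Or.inr ⟨rfl, k, m, hk, hm⟩⟩
  · obtain ⟨τ₁, h₁, τ₂, h₂, m, k, hm, hk⟩ := h.exists_samePair_of_diag_of_pos hf hS hn hpos hδ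
    exact ⟨τ₁, h₁, τ₂, h₂, Or.inr ⟨rfl, m, k, hm, hk⟩⟩

/-- Otherwise both entries would be inflexions of `M` with parallel tangents, excluded off the
diagonal by genericity. -/
theorem deriv_eq_zero_or_of_not_diag (h : f.ParallelPath S s t) (hf : f ∈ genericSet) {τ : ℝ}
    (hτ : τ ∈ S) (hn : ¬ ∃ n : ℤ, t τ = s τ + n)
    (h₀ : f.angularSpeed (s τ) * deriv s τ = 0) : deriv s τ = 0 ∨ deriv t τ = 0 := by
  by_contra! hne
  have h₁ := (mul_eq_zero.1 h₀).resolve_right hne.1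
  rw [h.angularSpeed_mul_deriv_eq hτ] at h₀
  have h₂ := (mul_eq_zero.1 h₀).resolve_right hne.2
  rw [angularSpeed_eq_zero_iff] at h₁ h₂
  exact hn (hf.2 _ _ h₁ h₂ (h.planeDet_eq_zero hτ))

theorem isInflexion_iff_of_not_diag (h : f.ParallelPath S s t) (hf : f ∈ genericSet) {lam : ℝ}
    (h0 : lam ≠ 0) (h1 : lam ≠ 1) {τ : ℝ} (hτ : τ ∈ S) (hn : ¬ ∃ n : ℤ, t τ = s τ + n) :
    IsInflexion (fun σ => f.pointMap lam (s σ, t σ)) τ ↔ f.angularSpeed (s τ) * deriv s τ = 0 := by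
  obtain ⟨c, hc₀, hc⟩ := h.exists_smul hτ
  rw [h.isInflexion_iff lam hτ hc, and_iff_right_iff_imp]
  intro h₀
  rcases h.deriv_eq_zero_or_of_not_diag hf hτ hn h₀ with hs | ht
  · rw [hs, mul_zero, zero_add]
    exact mul_ne_zero (mul_ne_zero (sub_ne_zero.2 h1.symm) (h.regular τ hτ hs)) hc₀
  · rw [ht, mul_zero, zero_mul, add_zero]
    exact mul_ne_zero h0 (h.symm.regular τ hτ ht)

theorem isInflexion_iff_of_diag (h : f.ParallelPath S s t) (hf : f.HasSimpleInflexions) {lam : ℝ}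
    (hlam : lam ≠ 1 / 2) {τ : ℝ} (hτ : τ ∈ S) {n : ℤ} (hn : t τ = s τ + n) :
    IsInflexion (fun σ => f.pointMap lam (s σ, t σ)) τ ↔ f.angularSpeed (s τ) * deriv s τ = 0 := by
  rw [h.isInflexion_iff lam (c := 1) hτ (by rw [hn, d_add_int, one_smul]), and_iff_right_iff_imp]
  intro _
  obtain ⟨ht, hs⟩ := h.deriv_eq_neg_of_diag hf hτ hn
  have h₁ : lam * deriv s τ + (1 - lam) * deriv t τ * 1 = (2 * (lam - 1 / 2)) * deriv s τ := by
    rw [ht]; ring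
  rw [h₁]
  exact mul_ne_zero (mul_ne_zero two_ne_zero (sub_ne_zero.2 hlam)) hs

/-- When `s' = 0`, the turning identity gives `κ(t) = 0` and its derivative gives `κ(s) s'' = κ'(t)
t'² ≠ 0`. Hence `s'' ≠ 0`, and the derivative of the product is `s'' t'`. -/
theorem deriv_mul_deriv_ne_zero (h : f.ParallelPath S s t) (hf : f.HasSimpleInflexions) {τ : ℝ}
    (hτ : τ ∈ S) (hs : deriv s τ = 0) :
    deriv (fun τ => deriv s τ * deriv t τ) τ ≠ 0 := by
  have ht := h.regular τ hτ hs
  have hd := ((h.hasDerivAt_deriv_fst τ).mul (h.symm.hasDerivAt_deriv_fst τ)).deriv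
  have h₁ := h.angularSpeed_mul_deriv_eq hτ
  rw [hs, mul_zero, eq_comm, mul_eq_zero] at h₁
  have hk := h₁.resolve_right ht
  have h₂ := h.deriv_turning_eq hτ
  rw [hs, hk, zero_pow two_ne_zero, mul_zero, zero_mul, zero_add, add_zero] at h₂
  have hne := mul_ne_zero (hf.deriv_angularSpeed_ne_zero hk) (pow_ne_zero 2 ht)
  rw [← h₂] at hne
  have hd' : deriv (fun τ => deriv s τ * deriv t τ) τ = deriv (deriv s) τ * deriv t τ := by
    refine hd.trans ?_
    rw [hs, zero_mul, add_zero]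
  rw [hd']
  exact mul_ne_zero (right_ne_zero_of_mul hne) ht

end ParallelPath

theorem deriv_eq_deriv_fst_snd {pair : ℝ → ℝ × ℝ} (h : ContDiff ℝ ∞ pair) (τ : ℝ) :
    deriv pair τ = (deriv (fun σ => (pair σ).1) τ, deriv (fun σ => (pair σ).2) τ) := by
  have hp := (h.differentiable (by simp) τ).hasDerivAt
  have h₁ : HasDerivAt (fun σ => (pair σ).1) (deriv pair τ).1 τ :=
    (ContinuousLinearMap.fst ℝ ℝ ℝ).hasFDerivAt.comp_hasDerivAt τ hp
  have h₂ : HasDerivAt (fun σ => (pair σ).2) (deriv pair τ).2 τ :=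
    (ContinuousLinearMap.snd ℝ ℝ ℝ).hasFDerivAt.comp_hasDerivAt τ hp
  rw [h₁.deriv, h₂.deriv]

theorem IsClosedBranch.parallelPath {lam : ℝ} {pair : ℝ → ℝ × ℝ} (h : f.IsClosedBranch lam pair) :
    f.ParallelPath univ (fun τ => (pair τ).1) (fun τ => (pair τ).2) where
  contDiff_fst := contDiff_fst.comp h.smooth
  contDiff_snd := contDiff_snd.comp h.smooth
  uniqueDiffOn := uniqueDiffOn_univ
  regular τ _ h₁ h₂ := h.regular τ (by rw [deriv_eq_deriv_fst_snd h.smooth, h₁, h₂]; rfl)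
  mem τ _ := h.mem τ

theorem IsOnShellBranch.parallelPath {pair : ℝ → ℝ × ℝ} (h : f.IsOnShellBranch pair) :
    f.ParallelPath (Icc 0 1) (fun τ => (pair τ).1) (fun τ => (pair τ).2) where
  contDiff_fst := contDiff_fst.comp h.smooth
  contDiff_snd := contDiff_snd.comp h.smooth
  uniqueDiffOn := uniqueDiffOn_Icc one_pos
  regular τ hτ h₁ h₂ := h.regular τ hτ (by
    rw [deriv_eq_deriv_fst_snd h.smooth, h₁, h₂]; rfl)
  mem τ hτ := h.mem τ hτ

theorem IsClosedBranch.periodic_turning {lam : ℝ} {pair : ℝ → ℝ × ℝ}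
    (h : f.IsClosedBranch lam pair) :
    Function.Periodic (fun τ => f.angularSpeed (pair τ).1 * deriv (fun σ => (pair σ).1) τ) 1 := by
  have hP := h.parallelPath
  intro τ
  have hshift : HasDerivAt (fun σ => (pair (σ + 1)).1) (deriv (fun σ => (pair σ).1) (τ + 1)) τ :=
    (hP.hasDerivAt_fst (τ + 1)).comp_add_const τ 1
  -- At each `σ` the period either preserves or exchanges the entries, possibly differently from
  -- point to point. One alternative occurs arbitrarily close to `τ`, which suffices to compare
  -- values and derivatives at `τ`.
  have hall : ∃ᶠ σ in 𝓝[≠] τ, (∃ m : ℤ, (pair (σ + 1)).1 = (pair σ).1 + m) ∨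
      ∃ m : ℤ, (pair (σ + 1)).1 = (pair σ).2 + m := by
    refine (Eventually.of_forall fun σ => ?_).frequently
    rcases (h.samePair_iff σ (σ + 1)).2 ⟨1, by simp⟩ with ⟨m, _, hm, _⟩ | ⟨_, m, _, hm, _⟩
    · exact Or.inl ⟨m, hm⟩
    · exact Or.inr ⟨m, hm⟩
  rw [frequently_or_distrib] at hall
  simp only
  rcases hall with hA | hB
  · obtain ⟨⟨m, hm⟩, hd⟩ := exists_int_and_deriv_eq_of_frequently (hP.hasDerivAt_fst τ) hshift hA
    rw [hm, hd, f.angularSpeed_add_int]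
  · obtain ⟨⟨m, hm⟩, hd⟩ := exists_int_and_deriv_eq_of_frequently (hP.symm.hasDerivAt_fst τ) hshift hB
    rw [hm, hd, f.angularSpeed_add_int]
    exact (hP.angularSpeed_mul_deriv_eq (mem_univ τ)).symm

theorem IsClosedBranch.isInflexion_iff {lam : ℝ} {pair : ℝ → ℝ × ℝ}
    (h : f.IsClosedBranch lam pair) (hf : f ∈ genericSet) (h0 : lam ≠ 0) (h1 : lam ≠ 1) (τ : ℝ) :
    IsInflexion (fun σ => f.pointMap lam (pair σ)) τ ↔
      f.angularSpeed (pair τ).1 * deriv (fun σ => (pair σ).1) τ = 0 := by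
  have hP := h.parallelPath
  by_cases hn : ∃ n : ℤ, (pair τ).2 = (pair τ).1 + n
  · obtain ⟨n, hn⟩ := hn
    by_cases hlam : lam = 1 / 2
    · obtain ⟨τ₁, h₁, τ₂, h₂, hsame⟩ := hP.exists_samePair_of_diag hf.1 univ_mem hn
        (half_pos one_pos)
      rw [← hlam] at hsame
      obtain ⟨k, hk⟩ := (h.samePair_iff τ₁ τ₂).1 hsame
      have hk₀ : (0 : ℝ) < k := by linarith [h₁.2, h₂.1]
      have hk₁ : (k : ℝ) < 1 := by linarith [h₁.1, h₂.2]
      have hk₀' : 0 < k := by exact_mod_cast hk₀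
      have hk₁' : k < 1 := by exact_mod_cast hk₁
      omega
    · exact hP.isInflexion_iff_of_diag hf.1 hlam (mem_univ τ) hn
  · exact hP.isInflexion_iff_of_not_diag hf h0 h1 (mem_univ τ) hn

theorem IsClosedBranch.finite_even_inflexions {lam : ℝ} {pair : ℝ → ℝ × ℝ}
    (h : f.IsClosedBranch lam pair) (hf : f ∈ genericSet) (h0 : lam ≠ 0) (h1 : lam ≠ 1) :
    {τ ∈ Ico (0 : ℝ) 1 | IsInflexion (fun σ => f.pointMap lam (pair σ)) τ}.Finite ∧
      Even {τ ∈ Ico (0 : ℝ) 1 | IsInflexion (fun σ => f.pointMap lam (pair σ)) τ}.ncard := by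
  simp only [h.isInflexion_iff hf h0 h1]
  exact finite_even_zeros_of_periodic h.parallelPath.differentiable_turning h.periodic_turning
    fun τ => h.parallelPath.deriv_turning_ne_zero hf.1 (mem_univ τ)

theorem IsOnShellBranch.not_diag {pair : ℝ → ℝ × ℝ} (h : f.IsOnShellBranch pair)
    (hf : f.HasSimpleInflexions) {τ : ℝ} (hτ : τ ∈ Ioo (0 : ℝ) 1) :
    ¬ ∃ n : ℤ, (pair τ).2 = (pair τ).1 + n := by
  rintro ⟨n, hn⟩
  obtain ⟨τ₁, h₁, τ₂, h₂, hsame⟩ := h.parallelPath.exists_samePair_of_diag hf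
    (Icc_mem_nhds hτ.1 hτ.2) hn (lt_min hτ.1 (sub_pos.2 hτ.2))
  have hl := min_le_left τ (1 - τ)
  have hr := min_le_right τ (1 - τ)
  have := h.injective τ₁ ⟨by linarith [h₁.1], by linarith [h₁.2, hτ.2]⟩ τ₂
    ⟨by linarith [h₂.1, hτ.1], by linarith [h₂.2]⟩ hsame
  linarith [h₁.2, h₂.1]

theorem IsOnShellBranch.finite_even_inflexions {pair : ℝ → ℝ × ℝ} (h : f.IsOnShellBranch pair)
    (hf : f ∈ genericSet) :
    {τ ∈ Ioo (0 : ℝ) 1 | IsInflexion (fun σ => f.pointMap (1 / 2) (pair σ)) τ}.Finite ∧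
      Even {τ ∈ Ioo (0 : ℝ) 1 | IsInflexion (fun σ => f.pointMap (1 / 2) (pair σ)) τ}.ncard := by
  have hP := h.parallelPath
  -- The turning speed vanishes at both ends, so it is traded for `s' t'`, which has the same zeros
  -- inside and is negative at the ends.
  have hset : {τ ∈ Ioo (0 : ℝ) 1 | IsInflexion (fun σ => f.pointMap (1 / 2) (pair σ)) τ} =
      {τ ∈ Ioo (0 : ℝ) 1 | deriv (fun σ => (pair σ).1) τ * deriv (fun σ => (pair σ).2) τ = 0} := by
    ext τ
    refine and_congr_right fun hτ => ?_
    have hτ' := Ioo_subset_Icc_self hτ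
    refine (hP.isInflexion_iff_of_not_diag hf (by norm_num) (by norm_num) hτ'
      (h.not_diag hf.1 hτ)).trans ⟨fun h₀ => ?_, fun h₀ => ?_⟩
    · exact mul_eq_zero.2 (hP.deriv_eq_zero_or_of_not_diag hf hτ' (h.not_diag hf.1 hτ) h₀)
    · rcases mul_eq_zero.1 h₀ with hs | ht
      · rw [hs, mul_zero]
      · rw [hP.angularSpeed_mul_deriv_eq hτ', ht, mul_zero]
  have hneg : ∀ τ ∈ Icc (0 : ℝ) 1, (∃ n : ℤ, (pair τ).2 = (pair τ).1 + n) →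
      deriv (fun σ => (pair σ).1) τ * deriv (fun σ => (pair σ).2) τ < 0 := by
    rintro τ hτ ⟨n, hn⟩
    obtain ⟨ht, hs⟩ := hP.deriv_eq_neg_of_diag hf.1 hτ hn
    rw [ht, mul_neg]
    exact neg_lt_zero.2 (mul_self_pos.2 hs)
  rw [hset]
  refine finite_even_zeros_Ioo
    (g := fun τ => deriv (fun σ => (pair σ).1) τ * deriv (fun σ => (pair σ).2) τ)
    (fun τ => (hP.hasDerivAt_deriv_fst τ).differentiableAt.mul
    (hP.symm.hasDerivAt_deriv_fst τ).differentiableAt) one_pos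
    (mul_pos_of_neg_of_neg (hneg 0 (by simp) h.start_diag) (hneg 1 (by simp) h.end_diag))
    fun τ hτ h₀ => ?_
  have hτ' := Ioo_subset_Icc_self hτ
  rcases mul_eq_zero.1 h₀ with hs | ht
  · exact hP.deriv_mul_deriv_ne_zero hf.1 hτ' hs
  · simpa only [mul_comm] using hP.symm.deriv_mul_deriv_ne_zero hf.1 hτ' ht

end RegularClosedCurve

theorem proposition5p15 :
    ∃ G : Set RegularClosedCurve, IsOpen G ∧ Dense G ∧
      ∀ f ∈ G, ∀ lam : ℝ, lam ≠ 0 → lam ≠ 1 →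
        (∀ pair : ℝ → ℝ × ℝ, f.IsClosedBranch lam pair →
          {τ ∈ Ico (0 : ℝ) 1 | IsInflexion (fun σ => f.pointMap lam (pair σ)) τ}.Finite ∧
          Even {τ ∈ Ico (0 : ℝ) 1 | IsInflexion (fun σ => f.pointMap lam (pair σ)) τ}.ncard) ∧
        (lam = 1 / 2 → ∀ pair : ℝ → ℝ × ℝ, f.IsOnShellBranch pair →
          {τ ∈ Ioo (0 : ℝ) 1 | IsInflexion (fun σ => f.pointMap lam (pair σ)) τ}.Finite ∧
          Even {τ ∈ Ioo (0 : ℝ) 1 | IsInflexion (fun σ => f.pointMap lam (pair σ)) τ}.ncard) := by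
  refine ⟨RegularClosedCurve.genericSet, RegularClosedCurve.isOpen_genericSet,
    RegularClosedCurve.dense_genericSet, fun f hf lam h0 h1 => ⟨fun pair h => ?_, ?_⟩⟩
  · exact h.finite_even_inflexions hf h0 h1
  · rintro rfl pair h
    exact h.finite_even_inflexions hf
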